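/- For $K\in\mathbb N$ and $\phi\in[0,1]$ let $\mathbf f_K(\phi)=[1,e^{-i2\pi\phi},\dots,e^{-i2\pi\phi(K-1)}]^T$. Let $M,N,L,M_p,N_p$ be integers with $0\le L<\min\{M,N\}$, $1\le M_p\le M$, $1\le N_p\le N$, and let $\sigma\in\mathbb R$. The channel matrices considered are $$\mathbf H=\sum_{l=0}^{L-1}c_l\,\mathbf f_M(\theta_l)\,\mathbf f_N^H(\tau_l)\in\mathbb C^{M\times N},\qquad c_l\in\mathbb C,\ \theta_l,\tau_l\in[0,1],$$ where the only restriction on the paths is that the pairs $(\theta_l,\tau_l)$ are pairwise distinct modulo $1$ (no minimal separation is assumed). Let $\mathcal M_p\subseteq\{0,\dots,M-1\}$ and $\mathcal N_p\subseteq\{0,\dots,N-1\}$ be independent random subsets, uniformly distributed among the subsets with $M_p$ and $N_p$ elements respectively, and let $\mathbf S_{\mathcal M_p}\in\{0,1\}^{M_p\times M}$, $\mathbf S_{\mathcal N_p}\in\{0,1\}^{N_p\times N}$ be the matrices extracting the corresponding rows. One observes $(\mathcal M_p,\mathcal N_p)$ and $$\mathbf Y=\mathbf S_{\mathcal M_p}\mathbf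 H\,\mathbf S_{\mathcal N_p}^T+\mathbf Z,$$ where $\mathbf Z\in\mathbb C^{M_p\times N_p}$ is independent of the subsets and has i.i.d. circularly symmetric complex Gaussian entries of mean zero and variance $\sigma^2$ (independent real and imaginary parts, each of variance $\sigma^2/2$). Let $\hat{\mathbf H}$ be any estimator, i.e. a measurable function of $(\mathcal M_p,\mathcal N_p,\mathbf Y)$ with values in $\mathbb C^{M\times N}$, that is unbiased: for every channel $\mathbf H$ as above, $\mathbb E(\hat{\mathbf H})$ exists and equals $\mathbf H$. Then, for every channel $\mathbf H$ as above, $$\frac1{MN}\,\mathbb E\bigl(\|\hat{\mathbf H}-\mathbf H\|^2\bigr)\ \ge\ \frac{2L\sigma^2}{M_pN_p},$$ where $\|\cdot\|$ is the Frobenius norm, the left side may be $+\infty$, and all expectations are over $\mathbf Z$, $\mathcal N_p$ and $\mathcal M_p$. (In particular, the bound holds for every integrable estimator that is unbiased conditionally on each pair of subsets.) -/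

import Mathlib

open MeasureTheory ProbabilityTheory
open scoped ENNReal NNReal Matrix.Norms.Frobenius

namespace PilotChannel

noncomputable section

/-- The complex exponential sequence `f_K(φ) = [1, e^{-i2πφ}, …, e^{-i2πφ(K-1)}]ᵀ`. -/
def expSeq (K : ℕ) (φ : ℝ) : Fin K → ℂ :=
  fun k => Complex.exp (-Complex.I * (2 * Real.pi * φ * (k : ℕ)))

/-- Admissible parameters of `L` propagation paths: complex gains, angles and delays in `[0, 1]`,
such that no two paths have both the same angle and the same delay. Angles and delays enter the
channel only modulo `1`, so "the same" is understood on the circle `ℝ / ℤ`. -/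
structure PathParams (L : ℕ) where
  /-- path gains -/
  gain : Fin L → ℂ
  /-- angles of arrival -/
  angle : Fin L → ℝ
  /-- path delays -/
  delay : Fin L → ℝ
  angle_mem : ∀ l, angle l ∈ Set.Icc (0 : ℝ) 1
  delay_mem : ∀ l, delay l ∈ Set.Icc (0 : ℝ) 1
  distinct : ∀ l l' : Fin L, (angle l : UnitAddCircle) = (angle l' : UnitAddCircle) →
    (delay l : UnitAddCircle) = (delay l' : UnitAddCircle) → l = l'

/-- The channel matrix `H = ∑ l, c_l f_M(θ_l) f_N(τ_l)ᴴ`. -/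
def channel (M N : ℕ) {L : ℕ} (p : PathParams L) : Matrix (Fin M) (Fin N) ℂ :=
  ∑ l, p.gain l • Matrix.vecMulVec (expSeq M (p.angle l)) (star (expSeq N (p.delay l)))

/-- Subsets of `{0, …, n-1}` with exactly `k` elements. -/
abbrev Selection (n k : ℕ) : Type := {s : Finset (Fin n) // s.card = k}

/-- The `k × n` downsampling matrix that extracts the rows with index in the selected set,
in increasing order. -/
def downsample {n k : ℕ} (s : Selection n k) : Matrix (Fin k) (Fin n) ℂ :=
  Matrix.of fun i j => if s.1.orderEmbOfFin s.2 i = j then 1 else 0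

/-- The (circularly symmetric) complex Gaussian law on `ℂ` of mean zero and variance `v`: real and
imaginary parts are independent real Gaussians of mean zero and variance `v / 2`. -/
def complexGaussian (v : ℝ≥0) : Measure ℂ :=
  ((gaussianReal 0 (v / 2)).prod (gaussianReal 0 (v / 2))).map
    Complex.measurableEquivRealProd.symm

/-- Outcomes of all random quantities: the antenna subset, the pilot subcarrier subset, and the
noise entries. -/
abbrev Outcome (M N Mp Np : ℕ) : Type :=
  (Selection M Mp × Selection N Np) × (Fin Mp → Fin Np → ℂ)

/-- The joint law: the two subsets are uniformly distributed, the noise entries are i.i.d. complex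
Gaussian of variance `σ ^ 2`, and the two subsets and the noise are independent. -/
def law (M N Mp Np : ℕ) (σ : ℝ) : Measure (Outcome M N Mp Np) :=
  ((uniformOn Set.univ).prod (uniformOn Set.univ)).prod
    (Measure.pi fun _ => Measure.pi fun _ => complexGaussian (Real.toNNReal (σ ^ 2)))

/-- The observation `Y = S_𝓜 H S_𝓝ᵀ + Z`. -/
def observe {M N Mp Np : ℕ} (H : Matrix (Fin M) (Fin N) ℂ) (ω : Outcome M N Mp Np) :
    Matrix (Fin Mp) (Fin Np) ℂ :=
  downsample ω.1.1 * H * (downsample ω.1.2).transpose + Matrix.of ω.2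

/-- An estimator computes a matrix from the antenna subset, the pilot subset, and the
observation. -/
abbrev Estimator (M N Mp Np : ℕ) : Type :=
  Selection M Mp → Selection N Np → Matrix (Fin Mp) (Fin Np) ℂ → Matrix (Fin M) (Fin N) ℂ

/-- The random matrix `Ĥ` that the estimator yields when the true channel is `H`. -/
def Estimator.estimate {M N Mp Np : ℕ} (T : Estimator M N Mp Np)
    (H : Matrix (Fin M) (Fin N) ℂ) (ω : Outcome M N Mp Np) : Matrix (Fin M) (Fin N) ℂ :=
  T ω.1.1 ω.1.2 (observe H ω)

/-- For fixed subsets, the estimate is a measurable function of the observation. -/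
def Estimator.IsMeasurable {M N Mp Np : ℕ} (T : Estimator M N Mp Np) : Prop :=
  ∀ (A : Selection M Mp) (B : Selection N Np) (m : Fin M) (n : Fin N),
    Measurable fun y : Fin Mp → Fin Np → ℂ => T A B (Matrix.of y) m n

/-- The estimator is unbiased over all channels with `L` paths: whatever the path parameters, the
mean of `Ĥ` exists and equals the true channel. The mean is over the noise and the subsets; an
integrable estimator which is unbiased conditionally on each pair of subsets has this property. -/
def Estimator.IsUnbiased {M N Mp Np : ℕ} (T : Estimator M N Mp Np) (L : ℕ) (σ : ℝ) : Prop :=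
  ∀ (p : PathParams L) (m : Fin M) (n : Fin N),
    Integrable (fun ω => T.estimate (channel M N p) ω m n) (law M N Mp Np σ) ∧
    ∫ ω, T.estimate (channel M N p) ω m n ∂(law M N Mp Np σ) = channel M N p m n

/-- The per-element mean squared error `(1 / (M N)) 𝔼 ‖Ĥ - H‖²` in the Frobenius norm, with value
`∞` when the error is not square integrable. -/
def Estimator.mse {M N Mp Np : ℕ} (T : Estimator M N Mp Np) (σ : ℝ)
    (H : Matrix (Fin M) (Fin N) ℂ) : ℝ≥0∞ :=
  ENNReal.ofReal (1 / ((M : ℝ) * (N : ℝ))) *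
    ∫⁻ ω, ENNReal.ofReal (‖T.estimate H ω - H‖ ^ 2) ∂(law M N Mp Np σ)

end

end PilotChannel

namespace PilotChannel

/-! The proof is a Cramér–Rao argument in the ambient real coordinates of the channel matrix instead
of the path parameters. Fix the true channel `H`, and let `G x` be the mean, when the channel is `H
+ x`, of the estimate minus `H`, in real coordinates. Unbiasedness says that `G` fixes `H' - H` for
every channel `H'` with `L` paths. If the error at `H` is square integrable, Gaussian likelihood
ratios express `G` as an integral under the law at `H`, so `G` is continuously differentiable; the
squared Frobenius norm of its derivative at `0` is then bounded on both sides.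

From above (`sum_sq_fderiv_tiltedMean_le`): the entries of the derivative pair the error coordinates
with the scores. Averaged over the random subsets, each real coordinate is observed `ρ = Mp Np / (M
N)` times, with noise variance `w = σ² / 2`, so the scores are orthogonal with common squared norm
`ρ / w`. Bessel's inequality bounds the squared norm by `ρ / w` times the mean squared error.

From below (`four_mul_le_sum_sq_fderiv`): at a channel in general position the derivative of `G`
fixes a tangent space of real dimension `4 L` (`tangent_injective`), and a matrix fixing a
`d`-dimensional space has squared Frobenius norm at least `d` (`finrank_le_sum_sq_of_fixes`). Where
gains vanish or angles or delays coincide, tangent vectors may be dependent, but channels in general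
position accumulate at `H`, so continuity of the derivative carries the bound over. Hence the
squared error is at least `4 L w / ρ = 2 L σ² M N / (Mp Np)`; if it is infinite there is nothing to
prove. -/

/-! ### Independence of tangent vectors by polynomial interpolation -/

theorem _root_.Polynomial.sum_fin_coeff_mul_pow {R : Type*} [CommSemiring R] {K : ℕ}
    {P : Polynomial R} (hP : P.natDegree < K) (x : R) :
    ∑ m : Fin K, P.coeff m * x ^ (m : ℕ) = P.eval x := by
  rw [Polynomial.eval_eq_sum_range' hP, Finset.sum_range]

theorem _root_.Polynomial.sum_fin_coeff_mul_natCast_mul_pow {R : Type*} [CommSemiring R] {K : ℕ}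
    {P : Polynomial R} (hP : P.natDegree < K) (x : R) :
    ∑ m : Fin K, P.coeff m * ((m : ℕ) * x ^ (m : ℕ)) = x * P.derivative.eval x := by
  rw [Polynomial.derivative_eval, Polynomial.sum_over_range' _ (by simp) K hP, Finset.sum_range,
    Finset.mul_sum]
  refine Finset.sum_congr rfl fun m _ => ?_
  rcases Nat.eq_zero_or_pos (m : ℕ) with h | h
  · simp [h]
  · obtain ⟨k, hk⟩ := Nat.exists_eq_add_of_lt h
    rw [hk]
    simp only [zero_add, Nat.add_sub_cancel, pow_succ]
    ring

/-- The functional `∑ P_m Q_n (·)` applied to a combination of tangent vectors, in terms of the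
values and derivatives of `P` and `Q` at the nodes. -/
theorem sum_eval_eq_zero_of_tangent_eq_zero {ι : Type*} [Fintype ι] {M N : ℕ}
    {x y g a b : ι → ℂ}
    (h : ∀ (m : Fin M) (n : Fin N),
      ∑ l, x l ^ (m : ℕ) * y l ^ (n : ℕ) * (g l + a l * (m : ℕ) + b l * (n : ℕ)) = 0)
    {P Q : Polynomial ℂ} (hP : P.natDegree < M) (hQ : Q.natDegree < N) :
    ∑ l, (g l * (P.eval (x l) * Q.eval (y l)) +
      a l * (x l * P.derivative.eval (x l) * Q.eval (y l)) +
      b l * (P.eval (x l) * (y l * Q.derivative.eval (y l)))) = 0 := by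
  have h0 : ∑ m : Fin M, ∑ n : Fin N, P.coeff m * Q.coeff n *
      ∑ l, x l ^ (m : ℕ) * y l ^ (n : ℕ) * (g l + a l * (m : ℕ) + b l * (n : ℕ)) = 0 := by
    simp [h]
  rw [← h0]
  simp only [← Polynomial.sum_fin_coeff_mul_pow hP, ← Polynomial.sum_fin_coeff_mul_pow hQ,
    ← Polynomial.sum_fin_coeff_mul_natCast_mul_pow hP,
    ← Polynomial.sum_fin_coeff_mul_natCast_mul_pow hQ, Finset.sum_mul_sum]
  simp only [Finset.mul_sum]
  rw [Finset.sum_congr rfl fun m _ => Finset.sum_comm, Finset.sum_comm]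
  refine Finset.sum_congr rfl fun l _ => ?_
  simp only [← Finset.sum_add_distrib]
  refine Finset.sum_congr rfl fun m _ => Finset.sum_congr rfl fun n _ => ?_
  ring

/-- Products `P(x) Q(y)` of Lagrange basis and nodal polynomials separate the coefficients: a nodal
polynomial vanishes at all nodes but has simple zeros there, so it sees only derivative terms. Its
degree is the number of nodes, whence the strict inequalities. -/
theorem tangent_coeff_eq_zero {ι : Type*} [Fintype ι] [DecidableEq ι] {M N : ℕ}
    (hM : Fintype.card ι < M) (hN : Fintype.card ι < N)
    {x y g a b : ι → ℂ} (hx : Function.Injective x) (hy : Function.Injective y)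
    (hx0 : ∀ l, x l ≠ 0) (hy0 : ∀ l, y l ≠ 0)
    (h : ∀ (m : Fin M) (n : Fin N),
      ∑ l, x l ^ (m : ℕ) * y l ^ (n : ℕ) * (g l + a l * (m : ℕ) + b l * (n : ℕ)) = 0) (l : ι) :
    g l = 0 ∧ a l = 0 ∧ b l = 0 := by
  have basis_deg (z : ι → ℂ) (hz : Function.Injective z) (l : ι) :
      (Lagrange.basis Finset.univ z l).natDegree < Fintype.card ι := by
    have := Lagrange.degree_basis (s := Finset.univ) (v := z) hz.injOn (Finset.mem_univ l)
    rw [Polynomial.natDegree_eq_of_degree_eq_some this, Finset.card_univ]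
    have : 0 < Fintype.card ι := Fintype.card_pos_iff.2 ⟨l⟩
    omega
  have basis_eval (z : ι → ℂ) (hz : Function.Injective z) (l k : ι) :
      (Lagrange.basis Finset.univ z l).eval (z k) = if k = l then 1 else 0 := by
    split_ifs with hkl
    · subst hkl
      exact Lagrange.eval_basis_self hz.injOn (Finset.mem_univ _)
    · exact Lagrange.eval_basis_of_ne (Ne.symm hkl) (Finset.mem_univ _)
  have nodal_deg (z : ι → ℂ) : (Lagrange.nodal Finset.univ z).natDegree = Fintype.card ι := by
    rw [Lagrange.natDegree_nodal, Finset.card_univ]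
  have nodal_eval (z : ι → ℂ) (k : ι) : (Lagrange.nodal Finset.univ z).eval (z k) = 0 :=
    Lagrange.eval_nodal_at_node (Finset.mem_univ k)
  have nodal_deriv (z : ι → ℂ) (hz : Function.Injective z) (k : ι) :
      (Lagrange.nodal Finset.univ z).derivative.eval (z k) ≠ 0 := by
    rw [Lagrange.eval_nodal_derivative_eval_node_eq (Finset.mem_univ k), Lagrange.eval_nodal,
      Finset.prod_ne_zero_iff]
    intro j hj
    exact sub_ne_zero.2 (hz.ne (Finset.ne_of_mem_erase hj).symm)
  -- With `P` the basis polynomial at `x l` and `Q` nodal for `y`, the terms in `g` and `a` contain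
  -- the factor `Q (y k) = 0`, and only `b l` survives.
  have hb : ∀ l, b l = 0 := fun l => by
    have := sum_eval_eq_zero_of_tangent_eq_zero h ((basis_deg x hx l).trans hM)
      ((nodal_deg y).trans_lt hN)
    simpa [nodal_eval, basis_eval x hx, hy0 l, nodal_deriv y hy l] using this
  have ha : ∀ l, a l = 0 := fun l => by
    have := sum_eval_eq_zero_of_tangent_eq_zero h ((nodal_deg x).trans_lt hM)
      ((basis_deg y hy l).trans hN)
    simpa [nodal_eval, basis_eval y hy, hx0 l, nodal_deriv x hx l] using this
  refine ⟨?_, ha l, hb l⟩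
  have := sum_eval_eq_zero_of_tangent_eq_zero h ((basis_deg x hx l).trans hM)
      ((basis_deg y hy l).trans hN)
  simpa [ha, hb, basis_eval y hy, basis_eval x hx] using this

/-! ### Frobenius norm of a matrix that fixes a subspace -/

/-- A square matrix fixing the image of an injective linear map has squared Frobenius norm at
least the dimension of that image. -/
theorem finrank_le_sum_sq_of_fixes {κ W : Type*} [Fintype κ] [DecidableEq κ] [AddCommGroup W]
    [Module ℝ W] (A : (κ → ℝ) →ₗ[ℝ] (κ → ℝ)) (D : W →ₗ[ℝ] (κ → ℝ)) (hD : Function.Injective D)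
    (hA : ∀ w, A (D w) = D w) :
    (Module.finrank ℝ W : ℝ) ≤ ∑ i, ∑ j, A (Pi.single j 1) i ^ 2 := by
  let e := (WithLp.linearEquiv 2 ℝ (κ → ℝ)).symm
  let B : EuclideanSpace ℝ κ →ₗ[ℝ] EuclideanSpace ℝ κ := e.toLinearMap ∘ₗ A ∘ₗ e.symm.toLinearMap
  let E : Submodule ℝ (EuclideanSpace ℝ κ) := LinearMap.range (e.toLinearMap ∘ₗ D)
  have hE : Module.finrank ℝ E = Module.finrank ℝ W :=
    LinearMap.finrank_range_of_inj (e.injective.comp hD)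
  have hB (u : E) : B u = u := by
    obtain ⟨_, w, rfl⟩ := u
    simp [B, hA]
  let u := stdOrthonormalBasis ℝ E
  let b := EuclideanSpace.basisFun κ ℝ
  have hu : Orthonormal ℝ (fun k => (u k : EuclideanSpace ℝ κ)) :=
    u.orthonormal.comp_linearIsometry E.subtypeₗᵢ
  have h1 (i : κ) : ∑ j, A (Pi.single j 1) i ^ 2 = ‖B.adjoint (b i)‖ ^ 2 := by
    rw [← b.sum_sq_norm_inner_right]
    refine Finset.sum_congr rfl fun j _ => ?_
    rw [real_inner_comm, LinearMap.adjoint_inner_left, real_inner_comm]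
    simp [b, B, e, PiLp.inner_apply, EuclideanSpace.basisFun_apply]
  -- Bessel's inequality for the `i`-th row; since `B` fixes each `u k`, the inner product with the
  -- row is just the `i`-th coordinate of `u k`.
  have h2 (i : κ) : ∑ k, (inner ℝ (u k : EuclideanSpace ℝ κ) (b i)) ^ 2 ≤
      ‖B.adjoint (b i)‖ ^ 2 := by
    refine le_trans (le_of_eq ?_) (hu.sum_inner_products_le (B.adjoint (b i)) (s := Finset.univ))
    refine Finset.sum_congr rfl fun k _ => ?_
    rw [LinearMap.adjoint_inner_right, hB, Real.norm_eq_abs, sq_abs]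
  calc (Module.finrank ℝ W : ℝ) = ∑ k, ‖(u k : EuclideanSpace ℝ κ)‖ ^ 2 := by
        have hn : ∀ k, ‖(u k : EuclideanSpace ℝ κ)‖ = 1 := hu.1
        simp [← hE, hn]
    _ = ∑ k, ∑ i, (inner ℝ (u k : EuclideanSpace ℝ κ) (b i)) ^ 2 := by
        refine Finset.sum_congr rfl fun k _ => ?_
        rw [← b.sum_sq_norm_inner_left]
        simp
    _ = ∑ i, ∑ k, (inner ℝ (u k : EuclideanSpace ℝ κ) (b i)) ^ 2 := Finset.sum_comm
    _ ≤ _ := Finset.sum_le_sum fun i _ => (h2 i).trans (h1 i).ge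

/-! ### Real coordinates and the differential of the channel -/

open Filter Topology

/-- Index set of the real coordinates of an `M × N` complex matrix; the flag `true` stands for the
real part, `false` for the imaginary part. -/
abbrev RealIndex (M N : ℕ) : Type := Fin M × Fin N × Bool

/-- The real part or the imaginary part of a complex number. -/
noncomputable def part (b : Bool) : ℂ →L[ℝ] ℝ := if b then Complex.reCLM else Complex.imCLM

@[simp] theorem part_true (z : ℂ) : part true z = z.re := by simp [part]

@[simp] theorem part_false (z : ℂ) : part false z = z.im := by simp [part]

/-- The real coordinates of a complex matrix. -/
noncomputable def coords (M N : ℕ) : Matrix (Fin M) (Fin N) ℂ →ₗ[ℝ] (RealIndex M N → ℝ) where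
  toFun H k := part k.2.2 (H k.1 k.2.1)
  map_add' _ _ := by ext; simp
  map_smul' r H := by
    ext k
    simp only [Matrix.smul_apply, Pi.smul_apply, RingHom.id_apply, map_smul]

theorem coords_apply {M N : ℕ} (H : Matrix (Fin M) (Fin N) ℂ) (k : RealIndex M N) :
    coords M N H k = part k.2.2 (H k.1 k.2.1) := rfl

theorem coords_injective (M N : ℕ) : Function.Injective (coords M N) := by
  intro H H' h
  ext m n
  apply Complex.ext
  · simpa [coords_apply] using congrFun h (m, n, true)
  · simpa [coords_apply] using congrFun h (m, n, false)

/-- The channel matrix as a function of unconstrained gains, angles and delays. -/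
noncomputable def rawChannel (M N : ℕ) {L : ℕ} (c : Fin L → ℂ) (θ τ : Fin L → ℝ) :
    Matrix (Fin M) (Fin N) ℂ :=
  ∑ l, c l • Matrix.vecMulVec (expSeq M (θ l)) (star (expSeq N (τ l)))

theorem channel_eq_rawChannel (M N : ℕ) {L : ℕ} (p : PathParams L) :
    channel M N p = rawChannel M N p.gain p.angle p.delay := rfl

theorem rawChannel_apply {M N L : ℕ} (c : Fin L → ℂ) (θ τ : Fin L → ℝ) (m : Fin M) (n : Fin N) :
    rawChannel M N c θ τ m n =
      ∑ l, c l * Complex.exp (2 * Real.pi * Complex.I * (τ l * (n : ℕ) - θ l * (m : ℕ))) := by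
  simp only [rawChannel, Matrix.sum_apply, Matrix.smul_apply, Matrix.vecMulVec_apply, expSeq,
    Pi.star_apply, smul_eq_mul, RCLike.star_def, ← Complex.exp_conj, ← Complex.exp_add]
  refine Finset.sum_congr rfl fun l _ => ?_
  congr 2
  simp [Complex.conj_ofNat]
  ring

/-- The derivative of the channel matrix in the direction `(γ, α, β)` of gains, angles, delays. -/
noncomputable def tangent (M N : ℕ) {L : ℕ} (c : Fin L → ℂ) (θ τ : Fin L → ℝ) :
    ((Fin L → ℂ) × (Fin L → ℝ) × (Fin L → ℝ)) →ₗ[ℝ] Matrix (Fin M) (Fin N) ℂ where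
  toFun d := Matrix.of fun m n => ∑ l,
    Complex.exp (2 * Real.pi * Complex.I * (τ l * (n : ℕ) - θ l * (m : ℕ))) *
      (d.1 l + c l * (2 * Real.pi * Complex.I * (d.2.2 l * (n : ℕ) - d.2.1 l * (m : ℕ))))
  map_add' d d' := by
    ext m n
    simp only [Matrix.of_apply, Matrix.add_apply, ← Finset.sum_add_distrib]
    refine Finset.sum_congr rfl fun l _ => ?_
    simp
    ring
  map_smul' r d := by
    ext m n
    simp only [Matrix.of_apply, Matrix.smul_apply, Finset.smul_sum]
    refine Finset.sum_congr rfl fun l _ => ?_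
    simp
    ring

theorem tangent_apply {M N L : ℕ} (c : Fin L → ℂ) (θ τ : Fin L → ℝ)
    (d : (Fin L → ℂ) × (Fin L → ℝ) × (Fin L → ℝ)) (m : Fin M) (n : Fin N) :
    tangent M N c θ τ d m n = ∑ l,
    Complex.exp (2 * Real.pi * Complex.I * (τ l * (n : ℕ) - θ l * (m : ℕ))) *
      (d.1 l + c l * (2 * Real.pi * Complex.I * (d.2.2 l * (n : ℕ) - d.2.1 l * (m : ℕ)))) := rfl

theorem hasDerivAt_rawChannel {M N L : ℕ} (c : Fin L → ℂ) (θ τ : Fin L → ℝ)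
    (d : (Fin L → ℂ) × (Fin L → ℝ) × (Fin L → ℝ)) (m : Fin M) (n : Fin N) :
    HasDerivAt (fun s : ℝ => rawChannel M N (c + s • d.1) (θ + s • d.2.1) (τ + s • d.2.2) m n)
      (tangent M N c θ τ d m n) 0 := by
  simp only [rawChannel_apply, tangent_apply]
  refine HasDerivAt.fun_sum fun l _ => ?_
  have hs : HasDerivAt (fun s : ℝ => (s : ℂ)) 1 0 := Complex.ofRealCLM.hasDerivAt
  have hlin (a b : ℂ) : HasDerivAt (fun s : ℝ => a + (s : ℂ) * b) b 0 := by
    simpa using (hs.mul_const b).const_add a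
  have h2 : HasDerivAt (fun s : ℝ => 2 * Real.pi * Complex.I *
      ((τ l + (s : ℂ) * d.2.2 l) * (n : ℕ) - (θ l + (s : ℂ) * d.2.1 l) * (m : ℕ)))
      (2 * Real.pi * Complex.I * (d.2.2 l * (n : ℕ) - d.2.1 l * (m : ℕ))) 0 :=
    (((hlin _ _).mul_const _).sub ((hlin _ _).mul_const _)).const_mul _
  have h3 := (hlin (c l) (d.1 l)).mul h2.cexp
  simp only [Complex.ofReal_zero, zero_mul, add_zero] at h3
  refine (h3.congr_deriv (by ring)).congr_of_eventuallyEq (Eventually.of_forall fun s => ?_)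
  simp

theorem exp_two_pi_mul_I_injOn {a b : ℝ} (ha : a ∈ Set.Ioo (0 : ℝ) 1) (hb : b ∈ Set.Ioo (0 : ℝ) 1)
    (h : Complex.exp (2 * Real.pi * Complex.I * a) = Complex.exp (2 * Real.pi * Complex.I * b)) :
    a = b := by
  obtain ⟨n, hn⟩ := Complex.exp_eq_exp_iff_exists_int.1 h
  have h1 : (2 * Real.pi * Complex.I : ℂ) * a = 2 * Real.pi * Complex.I * (b + n) := by
    rw [hn]; ring
  have h2 : (a : ℂ) = b + n := mul_left_cancel₀ Complex.two_pi_I_ne_zero h1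
  have h3 : a = b + n := by exact_mod_cast h2
  have hn1 : (n : ℝ) < 1 := by linarith [ha.2, hb.1]
  have hn2 : (-1 : ℝ) < n := by linarith [ha.1, hb.2]
  have : n = 0 := by
    have h4 : n < 1 := by exact_mod_cast hn1
    have h5 : -1 < n := by exact_mod_cast hn2
    omega
  simpa [this] using h3

/-! ### Channels in general position -/

/-- Pairwise distinct points of the open unit interval. -/
def Separated {L : ℕ} (φ : Fin L → ℝ) : Prop :=
  Function.Injective φ ∧ ∀ l, φ l ∈ Set.Ioo (0 : ℝ) 1

theorem tangent_injective {M N L : ℕ} (hM : L < M) (hN : L < N) {c : Fin L → ℂ}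
    {θ τ : Fin L → ℝ} (hc : ∀ l, c l ≠ 0) (hθ : Separated θ) (hτ : Separated τ) :
    Function.Injective (tangent M N c θ τ) := by
  rw [injective_iff_map_eq_zero]
  intro d hd
  have key := tangent_coeff_eq_zero (M := M) (N := N) (by simpa using hM) (by simpa using hN)
    -- Angles enter the channel with a negative sign, hence the inverse node here and the minus sign
    -- in `a`.
    (x := fun l => (Complex.exp (2 * Real.pi * Complex.I * θ l))⁻¹)
    (y := fun l => Complex.exp (2 * Real.pi * Complex.I * τ l))
    (g := d.1) (a := fun l => -(c l * (2 * Real.pi * Complex.I * d.2.1 l)))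
    (b := fun l => c l * (2 * Real.pi * Complex.I * d.2.2 l))
    (fun l l' h => hθ.1 (exp_two_pi_mul_I_injOn (hθ.2 l) (hθ.2 l') (inv_injective h)))
    (fun l l' h => hτ.1 (exp_two_pi_mul_I_injOn (hτ.2 l) (hτ.2 l') h))
    (fun l => inv_ne_zero (Complex.exp_ne_zero _)) (fun l => Complex.exp_ne_zero _)
    (fun m n => by
      have := congrFun (congrFun hd m) n
      rw [tangent_apply, Matrix.zero_apply] at this
      rw [← this]
      refine Finset.sum_congr rfl fun l _ => ?_
      rw [← Complex.exp_neg, ← Complex.exp_nat_mul, ← Complex.exp_nat_mul, ← Complex.exp_add]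
      congr 1
      · congr 1
        ring
      · ring)
  refine Prod.ext (funext fun l => (key l).1)
    (Prod.ext (funext fun l => ?_) (funext fun l => ?_))
  · have := (key l).2.1
    rw [neg_eq_zero, mul_eq_zero, mul_eq_zero] at this
    simpa [hc l, Real.pi_ne_zero] using this
  · have := (key l).2.2
    rw [mul_eq_zero, mul_eq_zero] at this
    simpa [hc l, Real.pi_ne_zero] using this

/-- Separated angles and delays define admissible path parameters. -/
def PathParams.ofSeparated {L : ℕ} (c : Fin L → ℂ) {θ τ : Fin L → ℝ} (hθ : Separated θ)
    (hτ : Separated τ) : PathParams L where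
  gain := c
  angle := θ
  delay := τ
  angle_mem l := Set.Ioo_subset_Icc_self (hθ.2 l)
  delay_mem l := Set.Ioo_subset_Icc_self (hτ.2 l)
  distinct l l' h _ := by
    refine hθ.1 ((AddCircle.coe_eq_coe_iff_of_mem_Ico (p := (1 : ℝ)) (a := 0) ?_ ?_).1 h) <;>
    · rw [zero_add]
      exact Set.Ioo_subset_Ico_self (hθ.2 _)

theorem Separated.eventually {X : Type*} [TopologicalSpace X] {L : ℕ} {φ : X → Fin L → ℝ} {x : X}
    (hφ : ContinuousAt φ x) (h : Separated (φ x)) : ∀ᶠ s in 𝓝 x, Separated (φ s) := by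
  have hc (l : Fin L) : ContinuousAt (fun s => φ s l) x := (continuousAt_pi.1 hφ) l
  have h1 : ∀ᶠ s in 𝓝 x, ∀ l l' : Fin L, l ≠ l' → φ s l ≠ φ s l' :=
    eventually_all.2 fun l => eventually_all.2 fun l' => by
      by_cases hl : l = l'
      · simp [hl]
      · filter_upwards [(hc l).ne_iff_eventually_ne (hc l') |>.1 (h.1.ne hl)] with s hs _ using hs
  have h2 : ∀ᶠ s in 𝓝 x, ∀ l, φ s l ∈ Set.Ioo (0 : ℝ) 1 :=
    eventually_all.2 fun l => (hc l).eventually (isOpen_Ioo.mem_nhds (h.2 l))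
  filter_upwards [h1, h2] with s hs1 hs2
  exact ⟨fun l l' hl => by_contra fun hne => hs1 l l' hne hl, hs2⟩

/-- The one-sided limit matters: for `a = 0` the segment does vanish at `t = 0`, and only there. -/
theorem eventually_interpolation_ne_zero {E : Type*} [NormedAddCommGroup E] [NormedSpace ℝ E]
    (a : E) {b : E} (hb : b ≠ 0) : ∀ᶠ t : ℝ in 𝓝[>] 0, (1 - t) • a + t • b ≠ 0 := by
  by_cases ha : a = 0
  · filter_upwards [self_mem_nhdsWithin] with t ht
    simpa [ha, hb] using (Set.mem_Ioi.1 ht).ne'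
  · have : ContinuousAt (fun t : ℝ => (1 - t) • a + t • b) 0 := by fun_prop
    exact (this.eventually_ne (by simpa using ha)).filter_mono nhdsWithin_le_nhds

/-- Any points of the unit interval become separated when moved towards separated ones. -/
theorem eventually_separated_interpolation {L : ℕ} {φ ψ : Fin L → ℝ}
    (hφ : ∀ l, φ l ∈ Set.Icc (0 : ℝ) 1) (hψ : Separated ψ) :
    ∀ᶠ t : ℝ in 𝓝[>] 0, Separated ((1 - t) • φ + t • ψ) := by
  have h1 : ∀ᶠ t : ℝ in 𝓝[>] 0, ∀ l l' : Fin L, l ≠ l' →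
      (1 - t) • (φ l - φ l') + t • (ψ l - ψ l') ≠ 0 :=
    eventually_all.2 fun l => eventually_all.2 fun l' => by
      by_cases hl : l = l'
      · simp [hl]
      · filter_upwards [eventually_interpolation_ne_zero (φ l - φ l')
          (sub_ne_zero.2 (hψ.1.ne hl))] with t ht _ using ht
  filter_upwards [h1, Ioo_mem_nhdsGT (zero_lt_one' ℝ)] with t ht ht01
  refine ⟨fun l l' hl => by_contra fun hne => ht l l' hne ?_, fun l => ?_⟩
  · simp only [Pi.add_apply, Pi.smul_apply, smul_eq_mul] at hl ⊢
    linarith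
  · simp only [Pi.add_apply, Pi.smul_apply, smul_eq_mul]
    have h1t : 0 < 1 - t := sub_pos.2 ht01.2
    constructor
    · have := mul_nonneg h1t.le (hφ l).1
      have := mul_pos ht01.1 (hψ.2 l).1
      linarith
    · have := mul_le_mul_of_nonneg_left (hφ l).2 h1t.le
      have := mul_lt_mul_of_pos_left (hψ.2 l).2 ht01.1
      linarith

/-- Equally spaced points of the open unit interval. -/
noncomputable def grid (L : ℕ) : Fin L → ℝ := fun l => ((l : ℝ) + 1) / (L + 1)

theorem separated_grid (L : ℕ) : Separated (grid L) := by
  unfold grid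
  have hL : (0 : ℝ) < L + 1 := by positivity
  refine ⟨fun l l' h => ?_, fun l => ⟨by positivity, ?_⟩⟩
  · have : ((l : ℕ) : ℝ) = (l' : ℕ) := by simpa [div_left_inj' hL.ne'] using h
    exact Fin.ext (by exact_mod_cast this)
  · rw [div_lt_one hL]
    have : ((l : ℕ) : ℝ) < L := by exact_mod_cast l.2
    linarith

/-! ### Lower bound for the derivative of the mean -/

/-- Differentiate `G (x s) = x s` along a curve of channels. Separation is an open condition, so the
curve consists of admissible channels near `s = 0`. -/
theorem fderiv_coords_tangent {M N L : ℕ} {G : (RealIndex M N → ℝ) → (RealIndex M N → ℝ)}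
    (hG : Differentiable ℝ G) (H : Matrix (Fin M) (Fin N) ℂ)
    (hfix : ∀ p : PathParams L, G (coords M N (channel M N p - H)) = coords M N (channel M N p - H))
    (c : Fin L → ℂ) {θ τ : Fin L → ℝ} (hθ : Separated θ) (hτ : Separated τ)
    (d : (Fin L → ℂ) × (Fin L → ℝ) × (Fin L → ℝ)) :
    fderiv ℝ G (coords M N (rawChannel M N c θ τ - H)) (coords M N (tangent M N c θ τ d)) =
      coords M N (tangent M N c θ τ d) := by
  let x : ℝ → RealIndex M N → ℝ := fun s =>
    coords M N (rawChannel M N (c + s • d.1) (θ + s • d.2.1) (τ + s • d.2.2) - H)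
  have hx : HasDerivAt x (coords M N (tangent M N c θ τ d)) 0 := by
    rw [hasDerivAt_pi]
    intro k
    simp only [x, coords_apply, Matrix.sub_apply]
    exact (part k.2.2).hasFDerivAt.comp_hasDerivAt 0
      ((hasDerivAt_rawChannel c θ τ d k.1 k.2.1).sub_const _)
  have hx0 : x 0 = coords M N (rawChannel M N c θ τ - H) := by simp [x]
  have h1 : HasDerivAt (fun s => G (x s)) (fderiv ℝ G (x 0) (coords M N (tangent M N c θ τ d))) 0 :=
    (hG (x 0)).hasFDerivAt.comp_hasDerivAt 0 hx
  have h2 : (fun s => G (x s)) =ᶠ[𝓝 0] x := by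
    have hθ' : ∀ᶠ s : ℝ in 𝓝 0, Separated (θ + s • d.2.1) :=
      Separated.eventually (φ := fun s : ℝ => θ + s • d.2.1) (by fun_prop) (by simpa using hθ)
    have hτ' : ∀ᶠ s : ℝ in 𝓝 0, Separated (τ + s • d.2.2) :=
      Separated.eventually (φ := fun s : ℝ => τ + s • d.2.2) (by fun_prop) (by simpa using hτ)
    filter_upwards [hθ', hτ'] with s hs hs'
    exact hfix (PathParams.ofSeparated (c + s • d.1) hs hs')
  rw [← hx0]
  exact h1.unique (hx.congr_of_eventuallyEq h2)

/-- A continuously differentiable map that fixes all channels with `L` paths has, at any of these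
channels, a derivative of squared Frobenius norm at least `4 L`. -/
theorem four_mul_le_sum_sq_fderiv {M N L : ℕ} (hM : L < M) (hN : L < N)
    {G : (RealIndex M N → ℝ) → (RealIndex M N → ℝ)} (hG : ContDiff ℝ 1 G) (p : PathParams L)
    (hfix : ∀ p' : PathParams L, G (coords M N (channel M N p' - channel M N p)) =
      coords M N (channel M N p' - channel M N p)) :
    4 * (L : ℝ) ≤ ∑ i, ∑ j, fderiv ℝ G 0 (Pi.single j 1) i ^ 2 := by
  -- A segment from the given parameters to the reference point with unit gains and equally spaced
  -- angles and delays; it is in general position for all small `t > 0`.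
  let c : ℝ → Fin L → ℂ := fun t => (1 - t) • p.gain + t • (1 : Fin L → ℂ)
  let θ : ℝ → Fin L → ℝ := fun t => (1 - t) • p.angle + t • grid L
  let τ : ℝ → Fin L → ℝ := fun t => (1 - t) • p.delay + t • grid L
  let x : ℝ → RealIndex M N → ℝ := fun t =>
    coords M N (rawChannel M N (c t) (θ t) (τ t) - channel M N p)
  let f : (RealIndex M N → ℝ) → ℝ := fun y => ∑ i, ∑ j, fderiv ℝ G y (Pi.single j 1) i ^ 2
  have hf : Continuous f := by
    have := hG.continuous_fderiv one_ne_zero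
    fun_prop
  have hx : Continuous x := by
    refine continuous_pi fun k => ?_
    simp only [x, coords_apply, Matrix.sub_apply, rawChannel_apply, c, θ, τ, Pi.add_apply,
      Pi.smul_apply]
    fun_prop
  have hx0 : x 0 = 0 := by simp [x, c, θ, τ, channel_eq_rawChannel]
  have hlim : Tendsto (fun t => f (x t)) (𝓝[>] 0) (𝓝 (f 0)) := by
    have := (hf.comp hx).tendsto 0
    simp only [Function.comp_apply, hx0] at this
    exact this.mono_left nhdsWithin_le_nhds
  refine ge_of_tendsto hlim ?_
  have hc : ∀ᶠ t : ℝ in 𝓝[>] 0, ∀ l, c t l ≠ 0 :=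
    eventually_all.2 fun l => eventually_interpolation_ne_zero (p.gain l) one_ne_zero
  filter_upwards [hc, eventually_separated_interpolation p.angle_mem (separated_grid L),
    eventually_separated_interpolation p.delay_mem (separated_grid L)] with t hct hθt hτt
  -- Each path contributes two real dimensions for its gain, one for its angle and one for its
  -- delay.
  have hrank : Module.finrank ℝ ((Fin L → ℂ) × (Fin L → ℝ) × (Fin L → ℝ)) = 4 * L := by
    simp [Module.finrank_prod, Module.finrank_pi_fintype]
    ring
  have := finrank_le_sum_sq_of_fixes (fderiv ℝ G (x t)).toLinearMap
    (coords M N ∘ₗ tangent M N (c t) (θ t) (τ t))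
    ((coords_injective M N).comp (tangent_injective hM hN hct hθt hτt))
    (fun d => fderiv_coords_tangent (hG.differentiable one_ne_zero) _ hfix _ hθt hτt d)
  rw [hrank] at this
  simpa using this

/-! ### Differentiation of Laplace transforms -/

section Laplace

variable {Ω V : Type*} [NormedAddCommGroup V] [NormedSpace ℝ V] {f : Ω → ℝ} {ℓ : Ω → V →L[ℝ] ℝ}

/-- The factor `‖ℓ ω‖` produced by differentiation is absorbed by `‖ℓ‖ ≤ exp ‖ℓ‖`, at the price of
`R + 1` in place of `R`. -/
theorem norm_laplace_integrand_le {R : ℝ} {x : V} (hx : ‖x‖ ≤ R) (ω : Ω) :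
    ‖(f ω * Real.exp (ℓ ω x)) • ℓ ω‖ ≤ ‖f ω * Real.exp ((R + 1) * ‖ℓ ω‖)‖ := by
  have h1 : ℓ ω x ≤ R * ‖ℓ ω‖ := by
    calc ℓ ω x ≤ ‖ℓ ω x‖ := Real.le_norm_self _
      _ ≤ ‖ℓ ω‖ * ‖x‖ := (ℓ ω).le_opNorm x
      _ ≤ R * ‖ℓ ω‖ := by rw [mul_comm]; gcongr
  have h2 : ‖ℓ ω‖ ≤ Real.exp ‖ℓ ω‖ := by linarith [Real.add_one_le_exp ‖ℓ ω‖]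
  rw [norm_smul, norm_mul, norm_mul, Real.norm_eq_abs (Real.exp _), Real.abs_exp,
    Real.norm_eq_abs (Real.exp _), Real.abs_exp, add_mul, one_mul, Real.exp_add, mul_assoc]
  gcongr

variable [MeasurableSpace Ω] {μ : Measure Ω}

theorem hasFDerivAt_laplace (hf : AEStronglyMeasurable f μ) (hℓ : AEStronglyMeasurable ℓ μ)
    (hint : ∀ C : ℝ, Integrable (fun ω => f ω * Real.exp (C * ‖ℓ ω‖)) μ) (x : V) :
    HasFDerivAt (fun x => ∫ ω, f ω * Real.exp (ℓ ω x) ∂μ)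
      (∫ ω, (f ω * Real.exp (ℓ ω x)) • ℓ ω ∂μ) x := by
  have hmeas (x : V) : AEStronglyMeasurable (fun ω => f ω * Real.exp (ℓ ω x)) μ :=
    hf.mul (Real.continuous_exp.comp_aestronglyMeasurable (hℓ.apply_continuousLinearMap x))
  refine hasFDerivAt_integral_of_dominated_of_fderiv_le (s := Metric.ball x 1)
    (F' := fun x ω => (f ω * Real.exp (ℓ ω x)) • ℓ ω)
    -- On the unit ball around `x` the norm is at most `‖x‖ + 1`; the second `+ 1` is the price of
    -- the factor `‖ℓ ω‖`.
    (bound := fun ω => ‖f ω * Real.exp ((‖x‖ + 1 + 1) * ‖ℓ ω‖)‖)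
    (Metric.ball_mem_nhds x one_pos) (Eventually.of_forall hmeas) ?_ ((hmeas x).smul hℓ) ?_
    (hint _).norm ?_
  · refine (hint ‖x‖).mono (hmeas x) (ae_of_all _ fun ω => ?_)
    rw [norm_mul, norm_mul, Real.norm_eq_abs (Real.exp _), Real.abs_exp,
      Real.norm_eq_abs (Real.exp _), Real.abs_exp, mul_comm ‖x‖]
    gcongr
    exact (Real.le_norm_self _).trans ((ℓ ω).le_opNorm x)
  · refine ae_of_all _ fun ω y hy => norm_laplace_integrand_le ?_ ω
    have := norm_le_norm_add_norm_sub' y x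
    have := (mem_ball_iff_norm.1 hy)
    linarith
  · refine ae_of_all _ fun ω y _ => ?_
    have := ((ℓ ω).hasFDerivAt (x := y)).exp.const_mul (f ω)
    rwa [smul_smul] at this

theorem contDiff_laplace (hf : AEStronglyMeasurable f μ) (hℓ : AEStronglyMeasurable ℓ μ)
    (hint : ∀ C : ℝ, Integrable (fun ω => f ω * Real.exp (C * ‖ℓ ω‖)) μ) :
    ContDiff ℝ 1 fun x => ∫ ω, f ω * Real.exp (ℓ ω x) ∂μ := by
  refine contDiff_one_iff_hasFDerivAt.2 ⟨_, ?_, hasFDerivAt_laplace hf hℓ hint⟩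
  refine continuous_iff_continuousAt.2 fun x => ?_
  refine continuousAt_of_dominated
    (bound := fun ω => ‖f ω * Real.exp ((‖x‖ + 1 + 1) * ‖ℓ ω‖)‖) ?_ ?_ (hint _).norm ?_
  · exact Eventually.of_forall fun y => (hf.mul
      (Real.continuous_exp.comp_aestronglyMeasurable (hℓ.apply_continuousLinearMap y))).smul hℓ
  · filter_upwards [Metric.ball_mem_nhds x one_pos] with y hy
    refine ae_of_all _ fun ω => norm_laplace_integrand_le ?_ ω
    have := norm_le_norm_add_norm_sub' y x
    have := (mem_ball_iff_norm.1 hy)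
    linarith
  · refine ae_of_all _ fun ω => ?_
    fun_prop

theorem integrable_laplace_deriv (hf : AEStronglyMeasurable f μ) (hℓ : AEStronglyMeasurable ℓ μ)
    (hint : ∀ C : ℝ, Integrable (fun ω => f ω * Real.exp (C * ‖ℓ ω‖)) μ) (x : V) :
    Integrable (fun ω => (f ω * Real.exp (ℓ ω x)) • ℓ ω) μ :=
  (hint (‖x‖ + 1)).mono ((hf.mul (Real.continuous_exp.comp_aestronglyMeasurable
    (hℓ.apply_continuousLinearMap x))).smul hℓ)
    (ae_of_all _ fun ω => norm_laplace_integrand_le le_rfl ω)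

end Laplace

/-- Bessel's inequality for orthogonal square integrable functions of equal norm. -/
theorem sum_sq_integral_mul_le {Ω ι : Type*} [MeasurableSpace Ω] {μ : Measure Ω} [Fintype ι]
    [DecidableEq ι] {f : Ω → ℝ} {s : ι → Ω → ℝ} (hf : MemLp f 2 μ) (hs : ∀ i, MemLp (s i) 2 μ)
    {c : ℝ} (hc : 0 < c) (horth : ∀ i j, ∫ ω, s i ω * s j ω ∂μ = if i = j then c else 0) :
    ∑ j, (∫ ω, f ω * s j ω ∂μ) ^ 2 ≤ c * ∫ ω, f ω ^ 2 ∂μ := by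
  set a : ι → ℝ := fun j => ∫ ω, f ω * s j ω ∂μ
  have hfs (j : ι) : Integrable (fun ω => f ω * s j ω) μ := hf.integrable_mul (hs j)
  have hss (i j : ι) : Integrable (fun ω => s i ω * s j ω) μ := (hs i).integrable_mul (hs j)
  -- `c f - ∑ a_j s_j` is `c` times the residual of the projection of `f` onto the span of the
  -- `s_j`; this scaling avoids division.
  have h1 : ∫ ω, (c * f ω - ∑ j, a j * s j ω) ^ 2 ∂μ =
      c ^ 2 * ∫ ω, f ω ^ 2 ∂μ - c * ∑ j, a j ^ 2 := by
    have hexp (ω : Ω) : (c * f ω - ∑ j, a j * s j ω) ^ 2 =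
        c ^ 2 * f ω ^ 2 - 2 * c * ∑ j, a j * (f ω * s j ω) +
          ∑ i, ∑ j, a i * a j * (s i ω * s j ω) := by
      have e1 : ∑ j, a j * (f ω * s j ω) = f ω * ∑ j, a j * s j ω := by
        rw [Finset.mul_sum]; exact Finset.sum_congr rfl fun _ _ => by ring
      have e2 : ∑ i, ∑ j, a i * a j * (s i ω * s j ω) = (∑ j, a j * s j ω) ^ 2 := by
        rw [sq, Finset.sum_mul_sum]
        exact Finset.sum_congr rfl fun _ _ => Finset.sum_congr rfl fun _ _ => by ring
      rw [e1, e2]; ring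
    simp_rw [hexp]
    have i1 : Integrable (fun ω => c ^ 2 * f ω ^ 2) μ := hf.integrable_sq.const_mul _
    have i2 : Integrable (fun ω => 2 * c * ∑ j, a j * (f ω * s j ω)) μ :=
      (integrable_finsetSum _ fun j _ => (hfs j).const_mul _).const_mul _
    have i3 : Integrable (fun ω => ∑ i, ∑ j, a i * a j * (s i ω * s j ω)) μ :=
      integrable_finsetSum _ fun i _ => integrable_finsetSum _ fun j _ => (hss i j).const_mul _
    have i12 : Integrable (fun ω => c ^ 2 * f ω ^ 2 - 2 * c * ∑ j, a j * (f ω * s j ω)) μ :=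
      i1.sub i2
    rw [integral_add i12 i3, integral_sub i1 i2, integral_const_mul, integral_const_mul,
      integral_finsetSum _ fun j _ => (hfs j).const_mul _,
      integral_finsetSum _ fun i _ => integrable_finsetSum _ fun j _ => (hss i j).const_mul _]
    simp_rw [integral_finsetSum _ fun j _ => (hss _ j).const_mul _, integral_const_mul, horth]
    simp only [mul_ite, mul_zero, Finset.sum_ite_eq, Finset.mem_univ, if_true, ← Finset.sum_mul]
    have haj (j : ι) : ∫ ω, f ω * s j ω ∂μ = a j := rfl
    simp only [haj, mul_comm _ c, ← sq]
    ring
  have h2 : 0 ≤ ∫ ω, (c * f ω - ∑ j, a j * s j ω) ^ 2 ∂μ := integral_nonneg fun ω => sq_nonneg _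
  rw [h1] at h2
  have h3 : c * (∑ j, a j ^ 2) ≤ c * (c * ∫ ω, f ω ^ 2 ∂μ) := by linarith
  exact le_of_mul_le_mul_left h3 hc

/-! ### Gaussian product measures and their translates -/

section Gaussian

variable {J : Type*} [Fintype J] {w : ℝ≥0}

theorem integrable_exp_mul_sum_abs_pi_gaussianReal (C : ℝ) :
    Integrable (fun y : J → ℝ => Real.exp (C * ∑ k, |y k|))
      (Measure.pi fun _ => gaussianReal 0 w) := by
  have : (fun y : J → ℝ => Real.exp (C * ∑ k, |y k|)) = fun y => ∏ k, Real.exp (C * |y k|) := by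
    ext y
    rw [← Real.exp_sum, Finset.mul_sum]
  rw [this]
  exact Integrable.fintype_prod (f := fun _ (t : ℝ) => Real.exp (C * |t|)) fun _ =>
    integrable_exp_mul_abs (integrable_exp_mul_gaussianReal C) (integrable_exp_mul_gaussianReal _)

theorem memLp_eval_pi_gaussianReal (k : J) :
    MemLp (fun y : J → ℝ => y k) 2 (Measure.pi fun _ => gaussianReal 0 w) :=
  (memLp_id_gaussianReal 2).comp_measurePreserving
    (measurePreserving_eval (fun _ : J => gaussianReal 0 w) k)

theorem integral_eval_mul_eval_pi_gaussianReal [DecidableEq J] (k k' : J) :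
    ∫ y : J → ℝ, y k * y k' ∂(Measure.pi fun _ => gaussianReal 0 w) =
      if k = k' then (w : ℝ) else 0 := by
  split_ifs with h
  · subst h
    rw [integral_comp_eval (μ := fun _ : J => gaussianReal 0 w) (i := k)
      (f := fun t : ℝ => t * t) (by fun_prop)]
    have := variance_id_gaussianReal (μ := 0) (v := w)
    rw [variance_eq_sub (memLp_id_gaussianReal' 2 (by simp))] at this
    simpa [integral_id_gaussianReal, sq] using this
  · have hind := (iIndepFun_pi (μ := fun _ : J => gaussianReal 0 w)
      (X := fun _ (t : ℝ) => t) fun _ => aemeasurable_id).indepFun h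
    have := hind.integral_fun_mul_eq_mul_integral
      (memLp_eval_pi_gaussianReal k).aestronglyMeasurable
      (memLp_eval_pi_gaussianReal k').aestronglyMeasurable
    rw [this, integral_comp_eval (μ := fun _ : J => gaussianReal 0 w) (i := k)
      (f := fun t : ℝ => t) (by fun_prop)]
    simp [integral_id_gaussianReal]

theorem gaussianReal_map_add_const_eq_withDensity (hw : w ≠ 0) (a : ℝ) :
    (gaussianReal 0 w).map (· + a) = (gaussianReal 0 w).withDensity
      fun t => ENNReal.ofReal (Real.exp (t / w * a - 1 / (2 * w) * a ^ 2)) := by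
  have hw' : (w : ℝ) ≠ 0 := by exact_mod_cast hw
  rw [gaussianReal_map_add_const, gaussianReal_of_var_ne_zero _ hw,
    gaussianReal_of_var_ne_zero _ hw, ← withDensity_mul _ (measurable_gaussianPDF 0 w)
      (by fun_prop)]
  congr 1
  ext t
  rw [Pi.mul_apply, gaussianPDF, gaussianPDF, ← ENNReal.ofReal_mul (gaussianPDFReal_nonneg _ _ _),
    gaussianPDFReal, gaussianPDFReal, mul_assoc _ (Real.exp _) (Real.exp _), ← Real.exp_add]
  congr 3
  field_simp
  ring

theorem pi_map_add_eq_withDensity {X : Type*} [MeasurableSpace X] [Add X] [MeasurableAdd X]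
    {ν : J → Measure X} [∀ k, IsProbabilityMeasure (ν k)] {a : J → X} {g : J → X → ℝ≥0∞}
    (hg : ∀ k, Measurable (g k)) (h : ∀ k, (ν k).map (· + a k) = (ν k).withDensity (g k)) :
    (Measure.pi ν).map (· + a) = (Measure.pi ν).withDensity fun y => ∏ k, g k (y k) := by
  have hprob (k : J) : IsProbabilityMeasure ((ν k).map (· + a k)) :=
    Measure.isProbabilityMeasure_map (by fun_prop)
  have h1 : (Measure.pi ν).map (· + a) = Measure.pi fun k => (ν k).map (· + a k) :=
    Measure.pi_map_pi (f := fun k t => t + a k) fun k => by fun_prop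
  rw [h1]
  refine Measure.pi_eq fun s hs => ?_
  rw [withDensity_apply _ (MeasurableSet.univ_pi hs),
    ← lintegral_indicator (MeasurableSet.univ_pi hs)]
  have h2 (y : J → X) : (Set.univ.pi s).indicator (fun y => ∏ k, g k (y k)) y =
      ∏ k, (s k).indicator (g k) (y k) := by
    by_cases hy : y ∈ Set.univ.pi s
    · rw [Set.indicator_of_mem hy]
      exact Finset.prod_congr rfl fun k _ => (Set.indicator_of_mem (hy k trivial) _).symm
    · rw [Set.indicator_of_notMem hy]
      obtain ⟨k, hk⟩ : ∃ k, y k ∉ s k := by simpa [Set.mem_pi] using hy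
      exact (Finset.prod_eq_zero (Finset.mem_univ k) (Set.indicator_of_notMem hk _)).symm
  simp_rw [h2]
  have hind := iIndepFun_pi (μ := ν) (X := fun k => (s k).indicator (g k))
    fun k => ((hg k).indicator (hs k)).aemeasurable
  rw [lintegral_prod_eq_prod_lintegral_of_indepFun _ _ hind
    fun k => ((hg k).indicator (hs k)).comp (measurable_pi_apply k)]
  refine Finset.prod_congr rfl fun k _ => ?_
  rw [h, withDensity_apply _ (hs k), ← lintegral_indicator (hs k)]
  exact (measurePreserving_eval ν k).lintegral_comp ((hg k).indicator (hs k))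

theorem pi_gaussianReal_map_add_eq_withDensity (hw : w ≠ 0) (a : J → ℝ) :
    (Measure.pi fun _ : J => gaussianReal 0 w).map (· + a) =
      (Measure.pi fun _ => gaussianReal 0 w).withDensity fun y =>
        ENNReal.ofReal (Real.exp (∑ k, (y k / w * a k - 1 / (2 * w) * a k ^ 2))) := by
  rw [pi_map_add_eq_withDensity (fun k => by fun_prop)
    fun k => gaussianReal_map_add_const_eq_withDensity hw (a k)]
  congr 1
  ext y
  rw [Real.exp_sum, ENNReal.ofReal_prod_of_nonneg fun _ _ => (Real.exp_pos _).le]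

/-- By Fubini, the shift may depend on the first component: for fixed `s` it is a translation of
`ν`. Here `s` will be the pair of subsets, which decides which channel entries are added to the
noise. -/
theorem prod_map_add_eq_withDensity {S E : Type*} [MeasurableSpace S] [MeasurableSpace E] [Add E]
    [MeasurableAdd₂ E] {κ : Measure S} [SFinite κ] {ν : Measure E} [SFinite ν] {a : S → E}
    (ha : Measurable a) {g : S × E → ℝ≥0∞} (hg : Measurable g)
    (h : ∀ s, ν.map (· + a s) = ν.withDensity fun y => g (s, y)) :
    (κ.prod ν).map (fun p => (p.1, p.2 + a p.1)) =
      (κ.prod ν).withDensity g := by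
  have hm : Measurable fun p : S × E => (p.1, p.2 + a p.1) := by fun_prop
  refine Measure.ext_of_lintegral _ fun f hf => ?_
  rw [lintegral_map hf hm, lintegral_withDensity_eq_lintegral_mul _ hg hf,
    lintegral_prod _ (show Measurable fun p : S × E => f (p.1, p.2 + a p.1) from
      hf.comp hm).aemeasurable, lintegral_prod _ (hg.mul hf).aemeasurable]
  refine lintegral_congr fun s => ?_
  have h1 : Measurable fun y => f (s, y) := by fun_prop
  have h2 : Measurable fun y => g (s, y) := hg.comp measurable_prodMk_left
  have := lintegral_map (μ := ν) h1 (measurable_add_const (a s))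
  rw [h s, lintegral_withDensity_eq_lintegral_mul _ h2 h1] at this
  exact this.symm

theorem integral_comp_eq_integral_mul_of_map_eq_withDensity {Ω : Type*} [MeasurableSpace Ω]
    {μ : Measure Ω} {φ : Ω → Ω} (hφ : Measurable φ) {E : Ω → ℝ} (hE : Measurable E)
    (hE0 : ∀ ω, 0 ≤ E ω) (h : μ.map φ = μ.withDensity fun ω => ENNReal.ofReal (E ω))
    {f : Ω → ℝ} (hf : Measurable f) : ∫ ω, f (φ ω) ∂μ = ∫ ω, f ω * E ω ∂μ := by
  rw [← integral_map (f := f) hφ.aemeasurable hf.aestronglyMeasurable, h,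
    integral_withDensity_eq_integral_toReal_smul (by fun_prop)
      (ae_of_all _ fun _ => ENNReal.ofReal_lt_top)]
  simp_rw [ENNReal.toReal_ofReal (hE0 _), smul_eq_mul, mul_comm]

end Gaussian

/-! ### Cramér–Rao inequality for a randomly masked Gaussian observation -/

section MaskedModel

variable {S J K : Type*} [Fintype J]

/-- The exponent of the likelihood ratio of a Gaussian observation in which the `k`-th entry
observes the parameter with index `emb s k`; the second argument stands for the squares of the
parameters. -/
noncomputable def maskedForm (w : ℝ≥0) (emb : S → J → K) (ω : S × (J → ℝ)) :
    ((K → ℝ) × (K → ℝ)) →L[ℝ] ℝ :=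
  ∑ k, ((ω.2 k / w) • (ContinuousLinearMap.proj (R := ℝ) (φ := fun _ : K => ℝ) (emb ω.1 k)).comp
      (ContinuousLinearMap.fst ℝ (K → ℝ) (K → ℝ)) -
    (1 / (2 * (w : ℝ))) • (ContinuousLinearMap.proj (R := ℝ) (φ := fun _ : K => ℝ)
      (emb ω.1 k)).comp (ContinuousLinearMap.snd ℝ (K → ℝ) (K → ℝ)))

theorem maskedForm_apply (w : ℝ≥0) (emb : S → J → K) (ω : S × (J → ℝ)) (x y : K → ℝ) :
    maskedForm w emb ω (x, y) =
      ∑ k, (ω.2 k / w * x (emb ω.1 k) - 1 / (2 * w) * y (emb ω.1 k)) := by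
  simp [maskedForm]

theorem norm_maskedForm_le [Fintype K] (w : ℝ≥0) (emb : S → J → K) (ω : S × (J → ℝ)) :
    ‖maskedForm w emb ω‖ ≤
      (1 / w) * ∑ k, |ω.2 k| + Fintype.card J * (1 / (2 * (w : ℝ))) := by
  have hw : (0 : ℝ) ≤ w := w.2
  refine ContinuousLinearMap.opNorm_le_bound _ (by positivity) fun x => ?_
  obtain ⟨x, y⟩ := x
  rw [maskedForm_apply]
  have hx (k : K) : ‖x k‖ ≤ ‖(x, y)‖ := (norm_le_pi_norm x k).trans (norm_fst_le (x, y))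
  have hy (k : K) : ‖y k‖ ≤ ‖(x, y)‖ := (norm_le_pi_norm y k).trans (norm_snd_le (x, y))
  calc ‖∑ k, (ω.2 k / w * x (emb ω.1 k) - 1 / (2 * w) * y (emb ω.1 k))‖
      ≤ ∑ k, ((1 / w) * |ω.2 k| + 1 / (2 * w)) * ‖(x, y)‖ := by
        refine norm_sum_le_of_le _ fun k _ => (norm_sub_le _ _).trans ?_
        rw [norm_mul, norm_mul, norm_div, Real.norm_eq_abs (ω.2 k), Real.norm_of_nonneg hw,
          Real.norm_of_nonneg (show (0 : ℝ) ≤ 1 / (2 * w) by positivity), add_mul]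
        gcongr
        · rw [one_div_mul_eq_div]
        · exact hx _
        · exact hy _
    _ = _ := by
        rw [← Finset.sum_mul, Finset.sum_add_distrib, ← Finset.mul_sum]
        simp

variable [MeasurableSpace S] [DiscreteMeasurableSpace S]

theorem stronglyMeasurable_maskedForm [Finite S] (w : ℝ≥0) (emb : S → J → K) :
    StronglyMeasurable (maskedForm w emb) := by
  unfold maskedForm
  refine Finset.stronglyMeasurable_fun_sum _ fun k _ => StronglyMeasurable.sub ?_ ?_
  · refine StronglyMeasurable.smul (Measurable.stronglyMeasurable (f := fun ω : S × (J → ℝ) =>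
      ω.2 k / (w : ℝ)) (by fun_prop)) ?_
    exact (StronglyMeasurable.of_discrete (f := fun s : S =>
      (ContinuousLinearMap.proj (R := ℝ) (φ := fun _ : K => ℝ) (emb s k)).comp
      (ContinuousLinearMap.fst ℝ (K → ℝ) (K → ℝ)))).comp_measurable measurable_fst
  · exact (StronglyMeasurable.of_discrete (f := fun s : S => (1 / (2 * (w : ℝ))) •
      (ContinuousLinearMap.proj (R := ℝ) (φ := fun _ : K => ℝ) (emb s k)).comp
      (ContinuousLinearMap.snd ℝ (K → ℝ) (K → ℝ)))).comp_measurable measurable_fst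

variable {κ : Measure S} {w : ℝ≥0} {emb : S → J → K}

/-- Shifting the parameter of the masked Gaussian model amounts to weighting by the likelihood
ratio. -/
theorem integral_shift_eq_integral_tilted [Finite S] [Fintype K] (hw : w ≠ 0) {f : S × (J → ℝ) → ℝ} (hf : Measurable f)
    (x : K → ℝ) :
    ∫ ω, f (ω.1, ω.2 + fun k => x (emb ω.1 k)) ∂κ.prod (Measure.pi fun _ => gaussianReal 0 w) =
      ∫ ω, f ω * Real.exp (maskedForm w emb ω (x, fun k => x k ^ 2))
        ∂κ.prod (Measure.pi fun _ => gaussianReal 0 w) := by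
  have ha : Measurable fun s : S => fun k => x (emb s k) := Measurable.of_discrete
  have hE : Measurable fun ω : S × (J → ℝ) =>
      Real.exp (maskedForm w emb ω (x, fun k => x k ^ 2)) :=
    Real.measurable_exp.comp
      ((ContinuousLinearMap.apply ℝ ℝ (x, fun k => x k ^ 2)).continuous.comp_stronglyMeasurable
        (stronglyMeasurable_maskedForm w emb)).measurable
  refine integral_comp_eq_integral_mul_of_map_eq_withDensity
    (φ := fun ω : S × (J → ℝ) => (ω.1, ω.2 + fun k => x (emb ω.1 k)))
    (measurable_fst.prodMk (measurable_snd.add (ha.comp measurable_fst))) hE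
    (fun _ => (Real.exp_pos _).le) ?_ hf
  refine prod_map_add_eq_withDensity (a := fun s k => x (emb s k))
    (g := fun ω : S × (J → ℝ) =>
      ENNReal.ofReal (Real.exp (maskedForm w emb ω (x, fun k => x k ^ 2)))) ha hE.ennreal_ofReal fun s => ?_
  rw [pi_gaussianReal_map_add_eq_withDensity hw]
  simp_rw [maskedForm_apply]

variable [IsProbabilityMeasure κ]

/-- Hölder's inequality: `f` is square integrable, and the exponential is too because the norm of
the form grows at most linearly in the Gaussian variables. -/
theorem integrable_mul_exp_norm_maskedForm [Finite S] [Fintype K] {f : S × (J → ℝ) → ℝ}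
    (hf : MemLp f 2 (κ.prod (Measure.pi fun _ => gaussianReal 0 w))) (C : ℝ) :
    Integrable (fun ω => f ω * Real.exp (C * ‖maskedForm w emb ω‖))
      (κ.prod (Measure.pi fun _ => gaussianReal 0 w)) := by
  have hw : (0 : ℝ) ≤ w := w.2
  have hmeas : AEStronglyMeasurable (fun ω => Real.exp (C * ‖maskedForm w emb ω‖))
      (κ.prod (Measure.pi fun _ => gaussianReal 0 w)) :=
    Real.continuous_exp.comp_aestronglyMeasurable
      ((stronglyMeasurable_maskedForm w emb).norm.const_mul C).aestronglyMeasurable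
  refine hf.integrable_mul ((memLp_two_iff_integrable_sq hmeas).2 ?_)
  have h1 := ((integrable_exp_mul_sum_abs_pi_gaussianReal (J := J) (w := w)
    (2 * |C| * (1 / w))).comp_snd κ).mul_const
      (Real.exp (2 * |C| * (Fintype.card J * (1 / (2 * (w : ℝ))))))
  refine h1.mono (hmeas.pow 2) (ae_of_all _ fun ω => ?_)
  rw [← Real.exp_add, ← Real.exp_nat_mul, Real.norm_eq_abs, Real.norm_eq_abs, Real.abs_exp,
    Real.abs_exp, Real.exp_le_exp]
  calc ((2 : ℕ) : ℝ) * (C * ‖maskedForm w emb ω‖) ≤ 2 * (|C| * ‖maskedForm w emb ω‖) := by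
        push_cast
        gcongr
        exact le_abs_self C
    _ ≤ 2 * (|C| * ((1 / w) * ∑ k, |ω.2 k| + Fintype.card J * (1 / (2 * (w : ℝ))))) := by
        gcongr
        exact norm_maskedForm_le w emb ω
    _ = _ := by ring

/-- The mean of the functions `f` when the parameter of the masked Gaussian model is `x`,
expressed under the law with parameter zero. -/
noncomputable def tiltedMean (κ : Measure S) (w : ℝ≥0) (emb : S → J → K)
    (f : K → S × (J → ℝ) → ℝ) (x : K → ℝ) (i : K) : ℝ :=
  ∫ ω, f i ω * Real.exp (maskedForm w emb ω (x, fun k => x k ^ 2))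
    ∂κ.prod (Measure.pi fun _ => gaussianReal 0 w)

theorem contDiff_tiltedMean [Finite S] [Fintype K] {f : K → S × (J → ℝ) → ℝ}
    (hf : ∀ i, MemLp (f i) 2 (κ.prod (Measure.pi fun _ => gaussianReal 0 w))) :
    ContDiff ℝ 1 (tiltedMean κ w emb f) := by
  refine contDiff_pi.2 fun i => ?_
  have h := contDiff_laplace (hf i).aestronglyMeasurable
    (stronglyMeasurable_maskedForm w emb).aestronglyMeasurable
    (integrable_mul_exp_norm_maskedForm (hf i))
  -- The log-likelihood ratio is quadratic in `x` but linear in the pair of `x` and its squares, so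
  -- the mean is a Laplace transform composed with a polynomial map.
  exact h.comp (g := fun x => ∫ ω, f i ω * Real.exp (maskedForm w emb ω x)
    ∂κ.prod (Measure.pi fun _ => gaussianReal 0 w))
    (f := fun x : K → ℝ => (x, fun k => x k ^ 2)) (by fun_prop)

/-- At the origin the likelihood ratio is `1` and the squares have derivative zero, so only the
linear part of the exponent, the score in direction `v`, remains. -/
theorem fderiv_tiltedMean_zero [Finite S] [Fintype K] {f : K → S × (J → ℝ) → ℝ}
    (hf : ∀ i, MemLp (f i) 2 (κ.prod (Measure.pi fun _ => gaussianReal 0 w))) (v : K → ℝ) (i : K) :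
    fderiv ℝ (tiltedMean κ w emb f) 0 v i =
      ∫ ω, f i ω * maskedForm w emb ω (v, 0)
        ∂κ.prod (Measure.pi fun _ => gaussianReal 0 w) := by
  have hq : HasFDerivAt (fun x : K → ℝ => (x, fun k => x k ^ 2))
      ((ContinuousLinearMap.id ℝ (K → ℝ)).prod 0) 0 := by
    refine (hasFDerivAt_id (0 : K → ℝ)).prodMk (hasFDerivAt_pi'.2 fun k => ?_)
    have h1 : HasFDerivAt (fun x : K → ℝ => x k)
        (ContinuousLinearMap.proj (R := ℝ) (φ := fun _ : K => ℝ) k) 0 :=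
      hasFDerivAt_apply k 0
    have h2 := h1.pow 2
    refine h2.congr_fderiv ?_
    ext
    simp
  have hm := (stronglyMeasurable_maskedForm w emb).aestronglyMeasurable
    (μ := κ.prod (Measure.pi fun _ => gaussianReal 0 w))
  have hF (i : K) := hasFDerivAt_laplace (hf i).aestronglyMeasurable hm
    (integrable_mul_exp_norm_maskedForm (hf i)) ((0 : K → ℝ), fun k => (0 : K → ℝ) k ^ 2)
  have hG : HasFDerivAt (tiltedMean κ w emb f) _ 0 :=
    hasFDerivAt_pi.2 fun i => HasFDerivAt.comp (g := fun x => ∫ ω, f i ω *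
      Real.exp (maskedForm w emb ω x) ∂κ.prod (Measure.pi fun _ => gaussianReal 0 w))
      (f := fun x : K → ℝ => (x, fun k => x k ^ 2)) (0 : K → ℝ) (hF i) hq
  have hz : ((0 : K → ℝ), fun _ : K => (0 : ℝ)) = 0 := rfl
  rw [hG.fderiv]
  simp only [ContinuousLinearMap.pi_apply, ContinuousLinearMap.comp_apply,
    ContinuousLinearMap.prod_apply, ContinuousLinearMap.id_apply, zero_apply]
  rw [ContinuousLinearMap.integral_apply (integrable_laplace_deriv (hf i).aestronglyMeasurable hm
    (integrable_mul_exp_norm_maskedForm (hf i)) _)]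
  simp [hz]

theorem memLp_maskedForm_fst [Fintype K] (v : K → ℝ) :
    MemLp (fun ω => maskedForm w emb ω (v, 0)) 2
      (κ.prod (Measure.pi fun _ => gaussianReal 0 w)) := by
  simp only [maskedForm_apply, Pi.zero_apply, mul_zero, sub_zero]
  refine memLp_finsetSum _ fun k _ => ?_
  have h1 : MemLp (fun ω : S × (J → ℝ) => ω.2 k) 2
      (κ.prod (Measure.pi fun _ => gaussianReal 0 w)) :=
    (memLp_eval_pi_gaussianReal k).comp_snd κ
  have hm : Measurable fun ω : S × (J → ℝ) => v (emb ω.1 k) :=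
    (Measurable.of_discrete (f := fun s => v (emb s k))).comp measurable_fst
  have hy : Measurable fun ω : S × (J → ℝ) => ω.2 k / (w : ℝ) := by fun_prop
  refine (h1.const_mul (‖v‖ / w)).mono (hy.mul hm).aestronglyMeasurable (ae_of_all _ fun ω => ?_)
  calc ‖ω.2 k / w * v (emb ω.1 k)‖ = ‖ω.2 k / w‖ * ‖v (emb ω.1 k)‖ := norm_mul _ _
    _ ≤ ‖ω.2 k / w‖ * ‖v‖ := by gcongr; exact norm_le_pi_norm v _
    _ = ‖‖v‖ / w * ω.2 k‖ := by
      rw [norm_div, norm_mul, norm_div, norm_norm]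
      ring

/-- The Fisher information is a multiple of the identity. Distinct observations have independent
centred noise, and one observation cannot see two coordinates; the diagonal counts the mean number
`ρ` of observations of a coordinate. -/
theorem integral_maskedForm_mul_maskedForm [Finite S] [DecidableEq K] (hw : w ≠ 0) {ρ : ℝ}
    (hρ : ∀ i : K, ∑ k, κ.real {s | emb s k = i} = ρ) (i j : K) :
    ∫ ω, maskedForm w emb ω (Pi.single i 1, 0) * maskedForm w emb ω (Pi.single j 1, 0)
      ∂κ.prod (Measure.pi fun _ => gaussianReal 0 w) = if i = j then ρ / w else 0 := by
  classical
  have hw' : (w : ℝ) ≠ 0 := by exact_mod_cast hw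
  have hexp (ω : S × (J → ℝ)) :
      maskedForm w emb ω (Pi.single i 1, 0) * maskedForm w emb ω (Pi.single j 1, 0) =
      ∑ k, ∑ k', (if emb ω.1 k = i ∧ emb ω.1 k' = j then 1 else 0) *
        ((1 / w) ^ 2 * (ω.2 k * ω.2 k')) := by
    simp only [maskedForm_apply, Pi.zero_apply, mul_zero, sub_zero, Finset.sum_mul_sum]
    refine Finset.sum_congr rfl fun k _ => Finset.sum_congr rfl fun k' _ => ?_
    simp only [Pi.single_apply, ite_and]
    split_ifs <;> ring
  have hint (k k' : J) : Integrable (fun ω : S × (J → ℝ) =>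
      (if emb ω.1 k = i ∧ emb ω.1 k' = j then (1 : ℝ) else 0) *
        ((1 / w) ^ 2 * (ω.2 k * ω.2 k'))) (κ.prod (Measure.pi fun _ => gaussianReal 0 w)) := by
    refine Integrable.mul_prod (f := fun s : S => if emb s k = i ∧ emb s k' = j then (1 : ℝ) else 0)
      (g := fun y : J → ℝ => (1 / (w : ℝ)) ^ 2 * (y k * y k')) Integrable.of_finite ?_
    exact ((memLp_eval_pi_gaussianReal k).integrable_mul
      (memLp_eval_pi_gaussianReal k')).const_mul _
  simp_rw [hexp]
  rw [integral_finsetSum _ fun k _ => integrable_finsetSum _ fun k' _ => hint k k']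
  simp_rw [integral_finsetSum _ fun k' _ => hint _ k']
  have hval (k k' : J) : ∫ ω : S × (J → ℝ),
      (if emb ω.1 k = i ∧ emb ω.1 k' = j then (1 : ℝ) else 0) *
        ((1 / w) ^ 2 * (ω.2 k * ω.2 k')) ∂κ.prod (Measure.pi fun _ => gaussianReal 0 w) =
      if k = k' then (if i = j then κ.real {s | emb s k = i} / w else 0) else 0 := by
    rw [integral_prod_mul (fun s : S => if emb s k = i ∧ emb s k' = j then (1 : ℝ) else 0)
      (fun y : J → ℝ => (1 / (w : ℝ)) ^ 2 * (y k * y k')), integral_const_mul,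
      integral_eval_mul_eval_pi_gaussianReal]
    split_ifs with hk hij
    · subst hk hij
      have : (fun s : S => if emb s k = i ∧ emb s k = i then (1 : ℝ) else 0) =
          Set.indicator {s | emb s k = i} 1 := by
        ext s
        simp [Set.indicator_apply]
      rw [this, integral_indicator_one (MeasurableSet.of_discrete)]
      field_simp
    · subst hk
      have : (fun s : S => if emb s k = i ∧ emb s k = j then (1 : ℝ) else 0) = 0 := by
        ext s
        refine if_neg fun h => hij (h.1.symm.trans h.2)
      simp [this]
    · simp
  simp_rw [hval]
  simp only [Finset.sum_ite_eq, Finset.mem_univ, if_true]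
  split_ifs with hij
  · rw [← Finset.sum_div, hρ]
  · simp

/-- The Cramér–Rao inequality of the masked Gaussian model. -/
theorem sum_sq_fderiv_tiltedMean_le [Finite S] [Fintype K] [DecidableEq K] (hw : w ≠ 0) {ρ : ℝ} (hρ0 : 0 < ρ)
    (hρ : ∀ i : K, ∑ k, κ.real {s | emb s k = i} = ρ) {f : K → S × (J → ℝ) → ℝ}
    (hf : ∀ i, MemLp (f i) 2 (κ.prod (Measure.pi fun _ => gaussianReal 0 w))) :
    ∑ i, ∑ j, fderiv ℝ (tiltedMean κ w emb f) 0 (Pi.single j 1) i ^ 2 ≤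
      ρ / w * ∑ i, ∫ ω, f i ω ^ 2 ∂κ.prod (Measure.pi fun _ => gaussianReal 0 w) := by
  have hw' : (0 : ℝ) < w := by exact_mod_cast pos_iff_ne_zero.2 hw
  rw [Finset.mul_sum]
  refine Finset.sum_le_sum fun i _ => ?_
  simp_rw [fderiv_tiltedMean_zero hf]
  exact sum_sq_integral_mul_le (hf i) (fun j => memLp_maskedForm_fst _) (div_pos hρ0 hw')
    (integral_maskedForm_mul_maskedForm hw hρ)

end MaskedModel

/-! ### The channel observation as a masked Gaussian model -/

theorem measurable_part (b : Bool) : Measurable (part b) := (part b).continuous.measurable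

instance (v : ℝ≥0) : IsProbabilityMeasure (complexGaussian v) :=
  Measure.isProbabilityMeasure_map (Complex.measurableEquivRealProd.symm.measurable.aemeasurable)

instance (n k : ℕ) : DiscreteMeasurableSpace (Selection n k) := by
  have : MeasurableSingletonClass (Finset (Fin n)) := ⟨fun s => by
    have h : {s} = ⋂ a, {t : Finset (Fin n) | a ∈ t ↔ a ∈ s} := by
      ext t
      simp [Finset.ext_iff]
    rw [h]
    refine MeasurableSet.iInter fun a => ?_
    exact measurableSet_setOfPred.2 ((measurable_finset_mem a).iff measurable_const)⟩
  infer_instance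

theorem nonempty_selection {n k : ℕ} (h : k ≤ n) : Nonempty (Selection n k) := by
  obtain ⟨s, _, hs⟩ := Finset.exists_subset_card_eq (s := (Finset.univ : Finset (Fin n))) (n := k)
    (by simpa using h)
  exact ⟨⟨s, hs⟩⟩

/-- Rearranges real coordinates into a complex array. -/
noncomputable def assemble {m n : ℕ} (y : RealIndex m n → ℝ) (i : Fin m) (j : Fin n) : ℂ :=
  ⟨y (i, j, true), y (i, j, false)⟩

theorem assemble_coords {m n : ℕ} (z : Fin m → Fin n → ℂ) :
    assemble (coords m n (Matrix.of z)) = z := by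
  ext i j
  apply Complex.ext <;> simp [coords_apply, assemble]

theorem measurable_assemble {m n : ℕ} : Measurable (assemble (m := m) (n := n)) := by
  refine measurable_pi_lambda _ fun i => measurable_pi_lambda _ fun j => ?_
  exact Complex.measurableEquivRealProd.symm.measurable.comp
    (f := fun y : RealIndex m n → ℝ => (y (i, j, true), y (i, j, false)))
    ((measurable_pi_apply _).prodMk (measurable_pi_apply _))

theorem measurable_coords_of {m n : ℕ} :
    Measurable fun z : Fin m → Fin n → ℂ => coords m n (Matrix.of z) := by
  refine measurable_pi_lambda _ fun k => ?_
  exact (measurable_part k.2.2).comp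
    ((measurable_pi_apply k.2.1).comp (measurable_pi_apply k.1))

theorem complexGaussian_rectangle (v : ℝ≥0) {s t : Set ℝ} (hs : MeasurableSet s)
    (ht : MeasurableSet t) : complexGaussian v {z | z.re ∈ s ∧ z.im ∈ t} =
      gaussianReal 0 (v / 2) s * gaussianReal 0 (v / 2) t := by
  rw [← Measure.prod_prod, complexGaussian, Measure.map_apply
    Complex.measurableEquivRealProd.symm.measurable
    (show MeasurableSet {z : ℂ | z.re ∈ s ∧ z.im ∈ t} from
      (Complex.measurable_re hs).inter (Complex.measurable_im ht))]
  rfl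

/-- Both laws are compared on boxes, where the complex product measure factors into real and
imaginary parts; each part carries half the variance. -/
theorem noise_map_coords (m n : ℕ) (v : ℝ≥0) :
    (Measure.pi fun _ : Fin m => Measure.pi fun _ : Fin n => complexGaussian v).map
      (fun z => coords m n (Matrix.of z)) = Measure.pi fun _ => gaussianReal 0 (v / 2) := by
  refine (Measure.pi_eq fun s hs => ?_).symm
  rw [Measure.map_apply measurable_coords_of (MeasurableSet.univ_pi hs)]
  have h : (fun z => coords m n (Matrix.of z)) ⁻¹' Set.univ.pi s =
      Set.univ.pi fun i => Set.univ.pi fun j =>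
        {z : ℂ | z.re ∈ s (i, j, true) ∧ z.im ∈ s (i, j, false)} := by
    ext z
    simp [Set.mem_pi, coords_apply, and_comm]
  rw [h, Measure.pi_pi, Fintype.prod_prod_type]
  refine Finset.prod_congr rfl fun i _ => ?_
  rw [Measure.pi_pi, Fintype.prod_prod_type]
  refine Finset.prod_congr rfl fun j _ => ?_
  rw [complexGaussian_rectangle v (hs _) (hs _), Fintype.prod_bool]

theorem noise_eq_map_assemble (m n : ℕ) (v : ℝ≥0) :
    (Measure.pi fun _ : Fin m => Measure.pi fun _ : Fin n => complexGaussian v) =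
      (Measure.pi fun _ : RealIndex m n => gaussianReal 0 (v / 2)).map assemble := by
  rw [← noise_map_coords, Measure.map_map measurable_assemble measurable_coords_of]
  simp [Function.comp_def, assemble_coords]

/-- The joint law of the two subsets. -/
noncomputable def subsetLaw (M N Mp Np : ℕ) : Measure (Selection M Mp × Selection N Np) :=
  (uniformOn Set.univ).prod (uniformOn Set.univ)

theorem law_eq_map (M N Mp Np : ℕ) (σ : ℝ) (hM : Mp ≤ M) (hN : Np ≤ N) :
    law M N Mp Np σ = ((subsetLaw M N Mp Np).prod (Measure.pi fun _ : RealIndex Mp Np =>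
      gaussianReal 0 (Real.toNNReal (σ ^ 2) / 2))).map (Prod.map id assemble) := by
  have := nonempty_selection hM
  have := nonempty_selection hN
  have : IsProbabilityMeasure (subsetLaw M N Mp Np) := by unfold subsetLaw; infer_instance
  rw [law, noise_eq_map_assemble, ← Measure.map_prod_map _ _ measurable_id measurable_assemble,
    Measure.map_id]
  rfl

/-- The coordinate of the channel seen by a given coordinate of the observation. -/
def pick {M N Mp Np : ℕ} (s : Selection M Mp × Selection N Np) (k : RealIndex Mp Np) :
    RealIndex M N :=
  (s.1.1.orderEmbOfFin s.1.2 k.1, s.2.1.orderEmbOfFin s.2.2 k.2.1, k.2.2)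

theorem downsample_mul_mul_transpose_apply {M N Mp Np : ℕ} (A : Selection M Mp)
    (B : Selection N Np) (X : Matrix (Fin M) (Fin N) ℂ) (i : Fin Mp) (j : Fin Np) :
    (downsample A * X * (downsample B).transpose) i j =
      X (A.1.orderEmbOfFin A.2 i) (B.1.orderEmbOfFin B.2 j) := by
  simp [Matrix.mul_apply, downsample]

/-- Changing the channel is the same as translating the noise by the selected entries of the
difference, which turns all channels into tilts of a single law. -/
theorem observe_assemble {M N Mp Np : ℕ} (H H' : Matrix (Fin M) (Fin N) ℂ)
    (s : Selection M Mp × Selection N Np) (y : RealIndex Mp Np → ℝ) :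
    observe H' (s, assemble y) =
      observe H (s, assemble (y + fun k => coords M N (H' - H) (pick s k))) := by
  ext i j
  simp only [observe, Matrix.add_apply, downsample_mul_mul_transpose_apply, Matrix.of_apply]
  apply Complex.ext <;>
  · simp [assemble, coords_apply, pick]
    ring

/-! ### Inclusion frequencies of uniform random subsets -/

theorem uniformOn_univ_real {Ω : Type*} [Fintype Ω] [MeasurableSpace Ω]
    [DiscreteMeasurableSpace Ω] (p : Ω → Prop) [DecidablePred p] :
    (uniformOn (Set.univ : Set Ω)).real {ω | p ω} =
      (Finset.univ.filter p).card / (Fintype.card Ω : ℝ) := by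
  rw [measureReal_def, uniformOn_univ, ENNReal.toReal_div,
    Measure.count_apply MeasurableSet.of_discrete]
  have : {ω | p ω} = ((Finset.univ.filter p : Finset Ω) : Set Ω) := by ext; simp
  rw [this, Set.encard_coe_eq_coe_finsetCard]
  simp

/-- Swapping `a` and `b` is an involution that exchanges the two families of subsets. -/
theorem card_filter_mem_selection (n k : ℕ) (a b : Fin n) :
    (Finset.univ.filter fun s : Selection n k => a ∈ s.1).card =
      (Finset.univ.filter fun s : Selection n k => b ∈ s.1).card := by
  let e : Selection n k → Selection n k := fun s =>
    ⟨s.1.map (Equiv.swap a b).toEmbedding, by rw [Finset.card_map]; exact s.2⟩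
  have he : ∀ s, e (e s) = s := fun s => by
    apply Subtype.ext
    ext x
    simp [e, Finset.mem_map_equiv]
  refine Finset.card_nbij' e e ?_ ?_ (fun s _ => he s) (fun s _ => he s) <;>
  · intro s hs
    simpa [e, Finset.mem_map_equiv] using hs

/-- The sum over positions is the probability that `a` is selected. By symmetry it does not depend
on `a`, and summed over all `n` elements it gives the size `k`. -/
theorem sum_uniformOn_real_orderEmbOfFin_eq {n k : ℕ} (h : k ≤ n) (hn : 0 < n) (a : Fin n) :
    ∑ i : Fin k, (uniformOn (Set.univ : Set (Selection n k))).real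
      {s | s.1.orderEmbOfFin s.2 i = a} = k / n := by
  have := nonempty_selection h
  have hcard : (Fintype.card (Selection n k) : ℝ) ≠ 0 := by
    exact_mod_cast Fintype.card_ne_zero
  have h1 (a : Fin n) : ∑ i : Fin k, (uniformOn (Set.univ : Set (Selection n k))).real
      {s | s.1.orderEmbOfFin s.2 i = a} =
      (Finset.univ.filter fun s : Selection n k => a ∈ s.1).card /
        (Fintype.card (Selection n k) : ℝ) := by
    simp_rw [uniformOn_univ_real, ← Finset.sum_div]
    congr 1
    norm_cast
    rw [← Finset.card_biUnion]
    · congr 1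
      ext s
      simp only [Finset.mem_biUnion, Finset.mem_filter, Finset.mem_univ, true_and]
      have := Finset.range_orderEmbOfFin s.1 s.2
      rw [← Finset.mem_coe, ← this, Set.mem_range]
    · intro i _ j _ hij
      refine Finset.disjoint_left.2 fun s hs hs' => hij ?_
      simp only [Finset.mem_filter, Finset.mem_univ, true_and] at hs hs'
      exact (s.1.orderEmbOfFin s.2).injective (hs.trans hs'.symm)
  have h2 : ∑ b : Fin n, ∑ i : Fin k, (uniformOn (Set.univ : Set (Selection n k))).real
      {s | s.1.orderEmbOfFin s.2 i = b} = k := by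
    rw [Finset.sum_comm]
    have h3 (i : Fin k) : ∑ b : Fin n, (uniformOn (Set.univ : Set (Selection n k))).real
        {s | s.1.orderEmbOfFin s.2 i = b} = 1 := by
      simp_rw [uniformOn_univ_real, ← Finset.sum_div]
      rw [div_eq_one_iff_eq hcard]
      norm_cast
      exact (Finset.card_eq_sum_card_fiberwise (f := fun s : Selection n k =>
        s.1.orderEmbOfFin s.2 i) (t := Finset.univ) (fun _ _ => Finset.mem_coe.2
          (Finset.mem_univ _))).symm
    simp [h3]
  simp_rw [h1, card_filter_mem_selection n k _ a] at h2 ⊢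
  have hn' : (n : ℝ) ≠ 0 := by exact_mod_cast hn.ne'
  rw [Finset.sum_const, Finset.card_univ, Fintype.card_fin, nsmul_eq_mul] at h2
  rw [eq_div_iff hn', mul_comm]
  exact h2

theorem sum_subsetLaw_real_pick_eq {M N Mp Np : ℕ} (hMpM : Mp ≤ M) (hNpN : Np ≤ N) (hM : 0 < M)
    (hN : 0 < N) (i : RealIndex M N) :
    ∑ k, (subsetLaw M N Mp Np).real {s | pick s k = i} = Mp * Np / (M * N) := by
  have := nonempty_selection hMpM
  have := nonempty_selection hNpN
  obtain ⟨m, n, b⟩ := i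
  have h (k : RealIndex Mp Np) : (subsetLaw M N Mp Np).real {s | pick s k = (m, n, b)} =
      if k.2.2 = b then (uniformOn (Set.univ : Set (Selection M Mp))).real
        {s | s.1.orderEmbOfFin s.2 k.1 = m} * (uniformOn (Set.univ : Set (Selection N Np))).real
        {s | s.1.orderEmbOfFin s.2 k.2.1 = n} else 0 := by
    split_ifs with hb
    · rw [subsetLaw, ← measureReal_prod_prod]
      congr 1
      ext s
      simp [pick, Prod.ext_iff, hb]
    · have : {s : Selection M Mp × Selection N Np | pick s k = (m, n, b)} = ∅ := by
        ext s
        simp [pick, hb]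
      simp [this]
  simp_rw [h, Fintype.sum_prod_type]
  simp only [Finset.sum_ite_eq', Finset.mem_univ, if_true]
  rw [← Finset.sum_mul_sum, sum_uniformOn_real_orderEmbOfFin_eq hMpM hM,
    sum_uniformOn_real_orderEmbOfFin_eq hNpN hN]
  exact div_mul_div_comm _ _ _ _

/-! ### Real coordinates of the estimation error -/

theorem sq_norm_eq_sum_sq_coords {M N : ℕ} (X : Matrix (Fin M) (Fin N) ℂ) :
    ‖X‖ ^ 2 = ∑ i, coords M N X i ^ 2 := by
  rw [Matrix.frobenius_norm_def, ← Real.rpow_natCast, ← Real.rpow_mul (by positivity)]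
  simp only [one_div, Nat.cast_ofNat, isUnit_iff_ne_zero, ne_eq, OfNat.ofNat_ne_zero,
    not_false_eq_true, IsUnit.inv_mul_cancel, Real.rpow_one, Fintype.sum_prod_type,
    Fintype.sum_bool, coords_apply, part_true, part_false, Real.rpow_ofNat]
  refine Finset.sum_congr rfl fun m _ => Finset.sum_congr rfl fun n _ => ?_
  rw [Complex.sq_norm, Complex.normSq_apply]
  ring

/-- The real coordinates of the estimation error, as functions of the subsets and of the real
coordinates of the noise. -/
noncomputable def errorCoord {M N Mp Np : ℕ} (T : Estimator M N Mp Np)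
    (H : Matrix (Fin M) (Fin N) ℂ) (i : RealIndex M N)
    (ω : (Selection M Mp × Selection N Np) × (RealIndex Mp Np → ℝ)) : ℝ :=
  coords M N (T.estimate H (Prod.map id assemble ω) - H) i

theorem measurable_estimate {M N Mp Np : ℕ} {T : Estimator M N Mp Np} (hT : T.IsMeasurable)
    (H : Matrix (Fin M) (Fin N) ℂ) (m : Fin M) (n : Fin N) :
    Measurable fun ω => T.estimate H ω m n := by
  refine measurable_from_prod_countable_right fun s => ?_
  have h : Measurable fun z : Fin Mp → Fin Np → ℂ =>
      (fun i j => (downsample s.1 * H * (downsample s.2).transpose) i j) + z :=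
    measurable_const_add _
  exact (hT s.1 s.2 m n).comp h

theorem measurable_errorCoord {M N Mp Np : ℕ} {T : Estimator M N Mp Np} (hT : T.IsMeasurable)
    (H : Matrix (Fin M) (Fin N) ℂ) (i : RealIndex M N) : Measurable (errorCoord T H i) :=
  (measurable_part i.2.2).comp (((measurable_estimate hT H i.1 i.2.1).comp
    (measurable_id.prodMap measurable_assemble)).sub_const _)

theorem errorCoord_shift {M N Mp Np : ℕ} (T : Estimator M N Mp Np)
    (H H' : Matrix (Fin M) (Fin N) ℂ) (i : RealIndex M N)
    (ω : (Selection M Mp × Selection N Np) × (RealIndex Mp Np → ℝ)) :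
    errorCoord T H i (ω.1, ω.2 + fun k => coords M N (H' - H) (pick ω.1 k)) =
      coords M N (T.estimate H' (Prod.map id assemble ω) - H) i := by
  simp only [errorCoord, Estimator.estimate, Prod.map_apply, id_eq,
    show Prod.map id assemble ω = (ω.1, assemble ω.2) from rfl, ← observe_assemble]

/-- Unbiasedness at the channel of `p`, read off from the error relative to the fixed channel `H`:
this is where the fixed points of the mean map come from. -/
theorem integral_errorCoord_shift {M N L Mp Np : ℕ} {σ : ℝ} (hMpM : Mp ≤ M) (hNpN : Np ≤ N)
    {T : Estimator M N Mp Np} (hmeas : T.IsMeasurable) (hunb : T.IsUnbiased L σ)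
    (H : Matrix (Fin M) (Fin N) ℂ) (p : PathParams L) (i : RealIndex M N) :
    ∫ ω, errorCoord T H i (ω.1, ω.2 + fun k => coords M N (channel M N p - H) (pick ω.1 k))
      ∂(subsetLaw M N Mp Np).prod (Measure.pi fun _ : RealIndex Mp Np =>
        gaussianReal 0 (Real.toNNReal (σ ^ 2) / 2)) = coords M N (channel M N p - H) i := by
  have := nonempty_selection hMpM
  have := nonempty_selection hNpN
  have hprob : IsProbabilityMeasure (law M N Mp Np σ) := by unfold law; infer_instance
  have hmE : Measurable fun ω => T.estimate (channel M N p) ω i.1 i.2.1 :=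
    measurable_estimate hmeas _ _ _
  have hm : Measurable fun ω => coords M N (T.estimate (channel M N p) ω - H) i :=
    (measurable_part i.2.2).comp (hmE.sub_const _)
  obtain ⟨hint, hmean⟩ := hunb p i.1 i.2.1
  simp_rw [errorCoord_shift]
  rw [← integral_map (f := fun ω => coords M N (T.estimate (channel M N p) ω - H) i)
    (measurable_id.prodMap measurable_assemble).aemeasurable hm.aestronglyMeasurable,
    ← law_eq_map M N Mp Np σ hMpM hNpN]
  simp only [coords_apply, Matrix.sub_apply]
  have hsub : Integrable (fun ω => T.estimate (channel M N p) ω i.1 i.2.1 - H i.1 i.2.1)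
      (law M N Mp Np σ) := hint.sub (integrable_const _)
  refine ((part i.2.2).integral_comp_comm hsub).trans ?_
  rw [integral_sub hint (integrable_const _), hmean]
  simp

theorem lintegral_sq_norm_eq {M N Mp Np : ℕ} {σ : ℝ} (hMpM : Mp ≤ M) (hNpN : Np ≤ N)
    {T : Estimator M N Mp Np} (hmeas : T.IsMeasurable) (H : Matrix (Fin M) (Fin N) ℂ) :
    ∫⁻ ω, ENNReal.ofReal (‖T.estimate H ω - H‖ ^ 2) ∂(law M N Mp Np σ) =
      ∑ i, ∫⁻ ω, ENNReal.ofReal (errorCoord T H i ω ^ 2)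
        ∂(subsetLaw M N Mp Np).prod (Measure.pi fun _ : RealIndex Mp Np =>
          gaussianReal 0 (Real.toNNReal (σ ^ 2) / 2)) := by
  have hm (i : RealIndex M N) : Measurable fun ω => coords M N (T.estimate H ω - H) i :=
    (measurable_part i.2.2).comp ((measurable_estimate hmeas H i.1 i.2.1).sub_const _)
  simp_rw [sq_norm_eq_sum_sq_coords]
  rw [law_eq_map M N Mp Np σ hMpM hNpN,
    lintegral_map (by fun_prop) (measurable_id.prodMap measurable_assemble),
    ← lintegral_finsetSum _ fun i _ => ((measurable_errorCoord hmeas H i).pow_const 2).ennreal_ofReal]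
  simp_rw [ENNReal.ofReal_sum_of_nonneg fun i _ => sq_nonneg (coords M N _ i)]
  rfl

end PilotChannel

/-! ### Combination of the two bounds -/

open PilotChannel in
theorem theorem1 (M N L Mp Np : ℕ) (σ : ℝ)
    (hLM : L < M) (hLN : L < N)
    (hMp : 1 ≤ Mp) (hMpM : Mp ≤ M) (hNp : 1 ≤ Np) (hNpN : Np ≤ N)
    (T : Estimator M N Mp Np) (hmeas : T.IsMeasurable) (hunb : T.IsUnbiased L σ)
    (p : PathParams L) :
    ENNReal.ofReal (2 * (L : ℝ) * σ ^ 2 / ((Mp : ℝ) * (Np : ℝ))) ≤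
      T.mse σ (channel M N p) := by
  rcases eq_or_ne σ 0 with rfl | hσ
  -- Without noise the lower bound is zero.
  · simp
  have hM : 0 < M := by omega
  have hN : 0 < N := by omega
  have hM' : (0 : ℝ) < M := by exact_mod_cast hM
  have hN' : (0 : ℝ) < N := by exact_mod_cast hN
  have hMp' : (0 : ℝ) < Mp := by exact_mod_cast hMp
  have hNp' : (0 : ℝ) < Np := by exact_mod_cast hNp
  have hσ2 : 0 < σ ^ 2 := by positivity
  have := nonempty_selection hMpM
  have := nonempty_selection hNpN
  have : IsProbabilityMeasure (subsetLaw M N Mp Np) := by unfold subsetLaw; infer_instance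
  set H := channel M N p
  set w : ℝ≥0 := Real.toNNReal (σ ^ 2) / 2 with hwdef
  have hw : (w : ℝ) = σ ^ 2 / 2 := by
    rw [hwdef, NNReal.coe_div, Real.coe_toNNReal _ hσ2.le, NNReal.coe_ofNat]
  have hw0 : w ≠ 0 := by
    rw [← NNReal.coe_ne_zero, hw]
    positivity
  set μ := (subsetLaw M N Mp Np).prod (Measure.pi fun _ : RealIndex Mp Np => gaussianReal 0 w)
    with hμ
  rw [Estimator.mse, lintegral_sq_norm_eq hMpM hNpN hmeas, ← hwdef, ← hμ]
  have hmE (i : RealIndex M N) := measurable_errorCoord hmeas H i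
  -- Square integrability is needed only at the true channel; at other channels the mean is computed
  -- by tilting.
  by_cases hfin : ∀ i, MemLp (errorCoord T H i) 2 μ
  · have hunb' (p' : PathParams L) : tiltedMean (subsetLaw M N Mp Np) w pick (errorCoord T H)
        (coords M N (channel M N p' - H)) = coords M N (channel M N p' - H) := by
      ext i
      rw [← integral_errorCoord_shift hMpM hNpN hmeas hunb H p' i, ← hwdef,
        integral_shift_eq_integral_tilted hw0 (hmE i)]
      rfl
    have hgeom := four_mul_le_sum_sq_fderiv hLM hLN (contDiff_tiltedMean hfin) p hunb'
    have hρ : (0 : ℝ) < Mp * Np / (M * N) := by positivity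
    have hcr := sum_sq_fderiv_tiltedMean_le hw0 hρ
      (sum_subsetLaw_real_pick_eq hMpM hNpN hM hN) hfin
    have hsum : ∑ i, ∫⁻ ω, ENNReal.ofReal (errorCoord T H i ω ^ 2) ∂μ =
        ENNReal.ofReal (∑ i, ∫ ω, errorCoord T H i ω ^ 2 ∂μ) := by
      rw [ENNReal.ofReal_sum_of_nonneg fun i _ => integral_nonneg fun ω => sq_nonneg _]
      exact Finset.sum_congr rfl fun i _ => (ofReal_integral_eq_lintegral_ofReal
        (hfin i).integrable_sq (ae_of_all _ fun ω => sq_nonneg _)).symm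
    rw [hsum, ← ENNReal.ofReal_mul (by positivity)]
    refine ENNReal.ofReal_le_ofReal ?_
    have h := hgeom.trans hcr
    rw [hw, ← hμ] at h
    set I := ∑ i, ∫ ω, errorCoord T H i ω ^ 2 ∂μ
    have e1 : 2 * (L : ℝ) * σ ^ 2 / (Mp * Np) = 4 * L * (σ ^ 2 / (2 * (Mp * Np))) := by
      field_simp
      ring
    have e2 : 1 / ((M : ℝ) * N) * I =
        Mp * Np / (M * N) / (σ ^ 2 / 2) * I * (σ ^ 2 / (2 * (Mp * Np))) := by
      field_simp
    rw [e1, e2]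
    exact mul_le_mul_of_nonneg_right h (by positivity)
  -- An error coordinate that is not square integrable makes the mean squared error infinite.
  · obtain ⟨i, hi⟩ := not_forall.1 hfin
    have htop : ∫⁻ ω, ENNReal.ofReal (errorCoord T H i ω ^ 2) ∂μ = ⊤ := by
      by_contra hne
      refine hi ((memLp_two_iff_integrable_sq (hmE i).aestronglyMeasurable).2
        ⟨((hmE i).pow_const 2).aestronglyMeasurable, ?_⟩)
      rw [hasFiniteIntegral_iff_ofReal (ae_of_all _ fun ω => sq_nonneg _)]
      exact lt_top_iff_ne_top.2 hne
    rw [ENNReal.sum_eq_top.2 ⟨i, Finset.mem_univ i, htop⟩, ENNReal.mul_top]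
    · exact le_top
    · rw [ne_eq, ENNReal.ofReal_eq_zero, not_le]
      positivity
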